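/- **Theorem (Representation theorem).** Let $(X,\Sigma,\mathfrak m)$ be a complete, $\sigma$-finite measure space, let $\mathscr M$ be a countably-generated normed $L^0(\mathfrak m)$-module, and let $\mathbb B$ be a universal separable Banach space. Then there exists a separable Banach $\mathbb B$-bundle $\mathbf E$ over $X$ such that $\Gamma(\mathbf E)\cong\mathscr M$ as normed $L^0(\mathfrak m)$-modules. Here the following terminology is used; all Banach spaces are real. * $L^0(\mathfrak m)$ is the commutative ring of $\mathfrak m$-a.e. equality classes of measurable functions $X\to\mathbb R$, with the distance $\mathsf d_{L^0(\mathfrak m)}(f,g)=\int |f-g|\wedge 1\,d\mathfrak m'$, where $\mathfrak m'$ is a probability measure with $\mathfrak m\ll\mathfrak m'\ll\mathfrak m$ (if $\mathfrak m=0$, take $\mathfrak m'=0$). * A *normed $L^0(\mathfrak m)$-module* is an $L^0(\mathfrak m)$-module $\mathscr M$ with a map $|\cdot|\colon\mathscr M\to L^0(\mathfrak m)$ (the pointwise norm) such that, $\mathfrak m$-a.e., $|v|\ge 0$ with equality if and only if $v=0$, $|v+w|\le|v|+|w|$ and $|f\cdot v|=|f||v|$ for all $v,w\in\mathscr M$,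 $f\in L^0(\mathfrak m)$, and such that the distance $\mathsf d_{\mathscr M}(v,w)=\mathsf d_{L^0(\mathfrak m)}(|v-w|,0)$ is complete. It is *countably-generated* if the $L^0(\mathfrak m)$-submodule spanned by some countable subset of $\mathscr M$ is $\mathsf d_{\mathscr M}$-dense in $\mathscr M$. A morphism $\Phi\colon\mathscr M\to\mathscr N$ is an $L^0(\mathfrak m)$-linear map with $|\Phi(v)|\le|v|$ $\mathfrak m$-a.e. for all $v\in\mathscr M$; $\cong$ denotes isomorphism in the resulting category. * A separable Banach space $\mathbb B$ is *universal* if every separable Banach space admits a linear isometric embedding into $\mathbb B$. * A *separable Banach $\mathbb B$-bundle* over $X$ is a map $\mathbf E$ from $X$ to the closed linear subspaces of $\mathbb B$ that is weakly measurable: $\{x\in X:\mathbf E(x)\cap U\ne\emptyset\}\in\Sigma$ for every open $U\subseteq\mathbb B$. * $\Gamma(\mathbf E)$ is the normed $L^0(\mathfrak m)$-module of $\mathfrak m$-a.e. equality classes of measurable maps $s\colon X\to\mathbb B$ with $s(x)\in\mathbf E(x)$ for every $x\in X$, with pointwise operations and pointwise norm $|s|(x)=\|s(x)\|_{\mathbb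 B}$. -/

import Mathlib

open MeasureTheory Filter Topology

noncomputable section

/-! ### The ring `L⁰(m)` of classes of measurable real functions and its distance -/

/-- The commutative ring structure of `L⁰(m)`, extending the additive group and the
multiplicative monoid structures of Mathlib. -/
instance instCommRingL0 {X : Type*} [MeasurableSpace X] (m : Measure X) :
    CommRing (X →ₘ[m] ℝ) :=
  { (inferInstance : AddCommGroup (X →ₘ[m] ℝ)), (inferInstance : CommMonoid (X →ₘ[m] ℝ)) with
    left_distrib := fun f g h => by
      induction f, g, h using AEEqFun.induction_on₃ with
      | _ f hf g hg h hh =>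
        simp only [AEEqFun.mk_add_mk, AEEqFun.mk_mul_mk, mul_add]
    right_distrib := fun f g h => by
      induction f, g, h using AEEqFun.induction_on₃ with
      | _ f hf g hg h hh =>
        simp only [AEEqFun.mk_add_mk, AEEqFun.mk_mul_mk, add_mul]
    zero_mul := fun f => by
      induction f using AEEqFun.induction_on with
      | _ f hf => simp only [AEEqFun.zero_def, AEEqFun.mk_mul_mk]; congr 1; ext x; simp
    mul_zero := fun f => by
      induction f using AEEqFun.induction_on with
      | _ f hf => simp only [AEEqFun.zero_def, AEEqFun.mk_mul_mk]; congr 1; ext x; simp }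

/-- The distance `∫ |f - g| ∧ 1 dm'` on `L⁰(m)`, where `m' = m.toFinite` is a probability measure
with `m ≪ m' ≪ m` (and `m' = 0` if `m = 0`). -/
def l0Dist {X : Type*} [MeasurableSpace X] {m : Measure X} [SigmaFinite m]
    (f g : X →ₘ[m] ℝ) : ℝ :=
  ∫ x, min |f x - g x| 1 ∂m.toFinite

/-! ### Normed `L⁰(m)`-modules -/

/-- Normed `L⁰(m)`-modules: an `L⁰(m)`-module with a pointwise norm whose associated distance
is complete. Order, absolute value and equality in `L⁰(m)` are `m`-a.e. notions. -/
class NormedL0Module {X : Type*} [MeasurableSpace X] (m : Measure X) [SigmaFinite m]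
    (M : Type*) [AddCommGroup M] [Module (X →ₘ[m] ℝ) M] where
  /-- the pointwise norm -/
  pnorm : M → (X →ₘ[m] ℝ)
  pnorm_nonneg : ∀ v : M, 0 ≤ pnorm v
  pnorm_eq_zero_iff : ∀ v : M, pnorm v = 0 ↔ v = 0
  pnorm_add_le : ∀ v w : M, pnorm (v + w) ≤ pnorm v + pnorm w
  pnorm_smul : ∀ (f : X →ₘ[m] ℝ) (v : M), pnorm (f • v) = |f| * pnorm v
  complete : ∀ u : ℕ → M,
    (∀ ε : ℝ, 0 < ε → ∃ N : ℕ, ∀ i ≥ N, ∀ j ≥ N, l0Dist (pnorm (u i - u j)) 0 < ε) →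
      ∃ v : M, Tendsto (fun n => l0Dist (pnorm (u n - v)) 0) atTop (𝓝 0)

namespace NormedL0Module

variable {X : Type*} [MeasurableSpace X] (m : Measure X) [SigmaFinite m]

/-- The distance of a normed `L⁰(m)`-module associated with its pointwise norm. -/
def moduleDist {M : Type*} [AddCommGroup M] [Module (X →ₘ[m] ℝ) M] [NormedL0Module m M]
    (v w : M) : ℝ :=
  l0Dist (pnorm (m := m) (v - w)) 0

/-- A normed `L⁰(m)`-module is countably-generated if the (algebraic) `L⁰(m)`-submodule spanned
by some countable subset is dense. -/
def CountablyGenerated (M : Type*) [AddCommGroup M] [Module (X →ₘ[m] ℝ) M]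
    [NormedL0Module m M] : Prop :=
  ∃ C : Set M, C.Countable ∧
    ∀ v : M, ∀ ε : ℝ, 0 < ε → ∃ w ∈ Submodule.span (X →ₘ[m] ℝ) C, moduleDist m v w < ε

/-- Morphisms of normed `L⁰(m)`-modules: `L⁰(m)`-linear contractions. -/
def IsMorphism {M N : Type*} [AddCommGroup M] [Module (X →ₘ[m] ℝ) M] [NormedL0Module m M]
    [AddCommGroup N] [Module (X →ₘ[m] ℝ) N] [NormedL0Module m N]
    (Φ : M →ₗ[X →ₘ[m] ℝ] N) : Prop :=
  ∀ v : M, pnorm (m := m) (Φ v) ≤ pnorm (m := m) v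

/-- Isomorphism in the category of normed `L⁰(m)`-modules. -/
def Isomorphic (M N : Type*) [AddCommGroup M] [Module (X →ₘ[m] ℝ) M] [NormedL0Module m M]
    [AddCommGroup N] [Module (X →ₘ[m] ℝ) N] [NormedL0Module m N] : Prop :=
  ∃ Φ : M ≃ₗ[X →ₘ[m] ℝ] N,
    IsMorphism m (Φ : M →ₗ[X →ₘ[m] ℝ] N) ∧ IsMorphism m (Φ.symm : N →ₗ[X →ₘ[m] ℝ] M)

end NormedL0Module

/-! ### Universal separable Banach spaces and separable Banach bundles -/

/-- The separable Banach space `B` is universal (up to linear isometry): it contains every separable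
Banach space. A separable Banach space has at most continuum many points, so the ones in `Type`
represent all of them up to linear isometry. -/
def IsUniversalSeparableBanach (B : Type*) [NormedAddCommGroup B] [NormedSpace ℝ B]
    [CompleteSpace B] [SecondCountableTopology B] : Prop :=
  ∀ (E : Type) [NormedAddCommGroup E] [NormedSpace ℝ E] [CompleteSpace E]
    [TopologicalSpace.SeparableSpace E], Nonempty (E →ₗᵢ[ℝ] B)

/-- A separable Banach `B`-bundle over `X`: a weakly measurable correspondence from `X` to `B`
whose values are closed linear subspaces of `B`. -/
structure SeparableBanachBundle (X : Type*) [MeasurableSpace X] (B : Type*)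
    [NormedAddCommGroup B] [NormedSpace ℝ B] where
  fiber : X → Submodule ℝ B
  isClosed_fiber : ∀ x, IsClosed (fiber x : Set B)
  weaklyMeasurable : ∀ U : Set B, IsOpen U →
    MeasurableSet {x : X | ((fiber x : Set B) ∩ U).Nonempty}

namespace SeparableBanachBundle

variable {X : Type*} [MeasurableSpace X] {B : Type*} [NormedAddCommGroup B] [NormedSpace ℝ B]
  [MeasurableSpace B] [BorelSpace B] [SecondCountableTopology B]

/-- The vector space of sections of `E`: measurable maps `s` with `s x ∈ E x` for every `x`. -/
def sections (E : SeparableBanachBundle X B) : Submodule ℝ (X → B) where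
  carrier := {s | Measurable s ∧ ∀ x, s x ∈ E.fiber x}
  add_mem' := fun hs ht => ⟨hs.1.add ht.1, fun x => (E.fiber x).add_mem (hs.2 x) (ht.2 x)⟩
  zero_mem' := ⟨measurable_const, fun x => (E.fiber x).zero_mem⟩
  smul_mem' := fun c _ hs => ⟨hs.1.const_smul c, fun x => (E.fiber x).smul_mem c (hs.2 x)⟩

/-- `Γ(E)`: the `L⁰(m)`-sections of `E`, that is, the `m`-a.e. equality classes of
sections of `E`. -/
def Gamma (m : Measure X) (E : SeparableBanachBundle X B) : AddSubgroup (X →ₘ[m] B) where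
  carrier := {s | ∃ σ ∈ E.sections, s =ᵐ[m] σ}
  add_mem' := by
    rintro s t ⟨σ, hσ, hs⟩ ⟨τ, hτ, ht⟩
    exact ⟨σ + τ, E.sections.add_mem hσ hτ, (AEEqFun.coeFn_add s t).trans (hs.add ht)⟩
  zero_mem' := ⟨0, E.sections.zero_mem, AEEqFun.coeFn_zero⟩
  neg_mem' := by
    rintro s ⟨σ, hσ, hs⟩
    exact ⟨-σ, E.sections.neg_mem hσ, (AEEqFun.coeFn_neg s).trans hs.neg⟩

variable (m : Measure X) (E : SeparableBanachBundle X B)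

/-- Pointwise multiplication `(f • s)(x) = f x • s x` of `L⁰(m)`-sections by elements of
`L⁰(m)`. -/
instance instSMulGamma : SMul (X →ₘ[m] ℝ) (E.Gamma m) where
  smul f s := ⟨AEEqFun.comp₂ (fun (a : ℝ) (b : B) => a • b) continuous_smul f s.1, by
    obtain ⟨σ, hσ, hs⟩ := s.2
    refine ⟨fun x => f x • σ x, ⟨f.measurable.smul hσ.1, fun x =>
      (E.fiber x).smul_mem _ (hσ.2 x)⟩, ?_⟩
    filter_upwards [AEEqFun.coeFn_comp₂ (fun (a : ℝ) (b : B) => a • b) continuous_smul f s.1, hs]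
      with x h1 h2
    rw [h1, h2]⟩

theorem coeFn_smul (f : X →ₘ[m] ℝ) (s : E.Gamma m) :
    ⇑(f • s : E.Gamma m).1 =ᵐ[m] fun x => f x • s.1 x :=
  AEEqFun.coeFn_comp₂ _ continuous_smul _ _

instance instModuleGamma : Module (X →ₘ[m] ℝ) (E.Gamma m) where
  one_smul s := by
    apply Subtype.ext; apply AEEqFun.ext
    filter_upwards [coeFn_smul m E 1 s, AEEqFun.coeFn_one (α := X) (β := ℝ) (μ := m)] with x h1 h2
    rw [h1, h2]; simp
  mul_smul f g s := by
    apply Subtype.ext; apply AEEqFun.ext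
    filter_upwards [coeFn_smul m E (f * g) s, coeFn_smul m E f (g • s), coeFn_smul m E g s,
      AEEqFun.coeFn_mul f g] with x h1 h2 h3 h4
    rw [h1, h2, h3, h4, Pi.mul_apply, mul_smul]
  smul_zero f := by
    apply Subtype.ext; apply AEEqFun.ext
    filter_upwards [coeFn_smul m E f 0, AEEqFun.coeFn_zero (α := X) (β := B) (μ := m)] with x h1 h2
    rw [h1, AddSubgroup.coe_zero, h2]; simp
  smul_add f s t := by
    apply Subtype.ext; apply AEEqFun.ext
    filter_upwards [coeFn_smul m E f (s + t), coeFn_smul m E f s, coeFn_smul m E f t,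
      AEEqFun.coeFn_add s.1 t.1, AEEqFun.coeFn_add (f • s).1 (f • t).1] with x h1 h2 h3 h4 h5
    rw [h1, AddSubgroup.coe_add, AddSubgroup.coe_add, h4, h5, Pi.add_apply, Pi.add_apply, h2, h3,
      smul_add]
  add_smul f g s := by
    apply Subtype.ext; apply AEEqFun.ext
    filter_upwards [coeFn_smul m E (f + g) s, coeFn_smul m E f s, coeFn_smul m E g s,
      AEEqFun.coeFn_add f g, AEEqFun.coeFn_add (f • s).1 (g • s).1] with x h1 h2 h3 h4 h5
    rw [h1, AddSubgroup.coe_add, h4, h5, Pi.add_apply, Pi.add_apply, h2, h3, add_smul]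
  zero_smul s := by
    apply Subtype.ext; apply AEEqFun.ext
    filter_upwards [coeFn_smul m E 0 s, AEEqFun.coeFn_zero (α := X) (β := ℝ) (μ := m),
      AEEqFun.coeFn_zero (α := X) (β := B) (μ := m)] with x h1 h2 h3
    rw [h1, AddSubgroup.coe_zero, h2, h3]; simp

/-- The pointwise norm of `Γ(E)`: the class of `x ↦ ‖s x‖`. -/
def gammaNorm (s : E.Gamma m) : X →ₘ[m] ℝ :=
  AEEqFun.comp (fun b : B => ‖b‖) continuous_norm s.1

theorem coeFn_gammaNorm (s : E.Gamma m) : ⇑(gammaNorm m E s) =ᵐ[m] fun x => ‖s.1 x‖ :=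
  AEEqFun.coeFn_comp _ _ _

theorem l0Dist_gammaNorm [SigmaFinite m] (s : E.Gamma m) {σ : X → B} (h : s.1 =ᵐ[m] σ) :
    l0Dist (gammaNorm m E s) 0 = ∫ x, min ‖σ x‖ 1 ∂m.toFinite := by
  unfold l0Dist
  apply integral_congr_ae
  have : ∀ᵐ x ∂m, min |gammaNorm m E s x - (0 : X →ₘ[m] ℝ) x| 1 = min ‖σ x‖ 1 := by
    filter_upwards [coeFn_gammaNorm m E s, h, AEEqFun.coeFn_zero (α := X) (β := ℝ) (μ := m)]
      with x h1 h2 h3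
    rw [h1, h2, h3]; simp
  rwa [← ae_toFinite] at this

theorem gamma_complete [SigmaFinite m] [CompleteSpace B] (u : ℕ → E.Gamma m)
    (hu : ∀ ε : ℝ, 0 < ε → ∃ N : ℕ, ∀ i ≥ N, ∀ j ≥ N,
      l0Dist (gammaNorm m E (u i - u j)) 0 < ε) :
    ∃ v : E.Gamma m, Tendsto (fun n => l0Dist (gammaNorm m E (u n - v)) 0) atTop (𝓝 0) := by
  choose σ hσ hu' using fun n => (u n).2
  have hm : ∀ n, Measurable (σ n) := fun n => (hσ n).1
  have hsub : ∀ s t : E.Gamma m, ∀ a b : X → B, s.1 =ᵐ[m] a → t.1 =ᵐ[m] b →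
      l0Dist (gammaNorm m E (s - t)) 0 = ∫ x, min ‖a x - b x‖ 1 ∂m.toFinite := by
    intro s t a b ha hb
    exact l0Dist_gammaNorm m E (s - t) (σ := a - b) ((AEEqFun.coeFn_sub s.1 t.1).trans (ha.sub hb))
  have hint : ∀ a b : X → B, Measurable a → Measurable b →
      Integrable (fun x => min ‖a x - b x‖ 1) m.toFinite := by
    intro a b ha hb
    refine Integrable.of_bound (C := 1)
      ((ha.sub hb).norm.min measurable_const).aestronglyMeasurable (ae_of_all _ fun x => ?_)
    rw [Real.norm_of_nonneg (le_min (norm_nonneg _) zero_le_one)]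
    exact min_le_right _ _
  choose N hN using fun k : ℕ => hu ((1 / 2 : ℝ) ^ k) (by positivity)
  let φ : ℕ → ℕ := fun k => (Finset.range (k + 1)).sup N + k
  have hφN : ∀ k, N k ≤ φ k := fun k =>
    (Finset.le_sup (f := N) (Finset.self_mem_range_succ k)).trans (Nat.le_add_right _ _)
  have hφN' : ∀ k, N k ≤ φ (k + 1) := fun k =>
    (Finset.le_sup (f := N) (Finset.mem_range.2 (by omega : k < k + 1 + 1))).trans
      (Nat.le_add_right _ _)
  have hφ : ∀ k, k ≤ φ k := fun k => Nat.le_add_left _ _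
  have hD : ∀ k, ∫ x, min ‖σ (φ k) x - σ (φ (k + 1)) x‖ 1 ∂m.toFinite ≤ (1 / 2 : ℝ) ^ k := by
    intro k
    rw [← hsub (u (φ k)) (u (φ (k + 1))) _ _ (hu' _) (hu' _)]
    exact (hN k _ (hφN k) _ (hφN' k)).le
  have hsum : ∀ᵐ x ∂m.toFinite,
      Summable fun k => min ‖σ (φ k) x - σ (φ (k + 1)) x‖ 1 := by
    have hmeas : ∀ k, Measurable fun x =>
        ENNReal.ofReal (min ‖σ (φ k) x - σ (φ (k + 1)) x‖ 1) := fun k =>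
      (((hm _).sub (hm _)).norm.min measurable_const).ennreal_ofReal
    have h1 : ∫⁻ x, ∑' k, ENNReal.ofReal (min ‖σ (φ k) x - σ (φ (k + 1)) x‖ 1) ∂m.toFinite ≠ ⊤ := by
      rw [lintegral_tsum fun k => (hmeas k).aemeasurable]
      have h2 : ∀ k, ∫⁻ x, ENNReal.ofReal (min ‖σ (φ k) x - σ (φ (k + 1)) x‖ 1) ∂m.toFinite
          ≤ ENNReal.ofReal ((1 / 2 : ℝ) ^ k) := by
        intro k
        rw [← ofReal_integral_eq_lintegral_ofReal (hint _ _ (hm _) (hm _))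
          (ae_of_all _ fun x => le_min (norm_nonneg _) zero_le_one)]
        exact ENNReal.ofReal_le_ofReal (hD k)
      refine ne_top_of_le_ne_top ?_ (ENNReal.tsum_le_tsum h2)
      exact (summable_geometric_two).tsum_ofReal_ne_top
    filter_upwards [ae_lt_top (Measurable.tsum hmeas) h1] with x hx
    have h3 := ENNReal.summable_toReal hx.ne
    refine h3.congr fun k => ?_
    rw [ENNReal.toReal_ofReal (le_min (norm_nonneg _) zero_le_one)]
  have hconv : ∀ᵐ x ∂m.toFinite, ∃ c, Tendsto (fun k => σ (φ k) x) atTop (𝓝 c) := by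
    filter_upwards [hsum] with x hx
    refine cauchySeq_tendsto_of_complete (cauchySeq_of_summable_dist ?_)
    have h4 : ∀ᶠ k in atTop, min ‖σ (φ k) x - σ (φ (k + 1)) x‖ 1 < 1 :=
      hx.tendsto_atTop_zero.eventually (gt_mem_nhds zero_lt_one)
    refine (summable_congr_atTop ?_).1 hx
    filter_upwards [h4] with k hk
    rw [dist_eq_norm]
    exact min_eq_left (by
      by_contra hc
      rw [min_eq_right (not_le.1 hc).le] at hk
      exact lt_irrefl _ hk)
  have hK : MeasurableSet {x | ∃ c, Tendsto (fun k => σ (φ k) x) atTop (𝓝 c)} :=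
    measurableSet_exists_tendsto fun k => hm (φ k)
  classical
  let K := {x | ∃ c, Tendsto (fun k => σ (φ k) x) atTop (𝓝 c)}
  let τ : X → B := fun x => if h : x ∈ K then h.choose else 0
  have hτ : ∀ x, Tendsto (fun k => K.indicator (σ (φ k)) x) atTop (𝓝 (τ x)) := by
    intro x
    by_cases h : x ∈ K
    · simp only [τ, dif_pos h, Set.indicator_of_mem h]
      exact h.choose_spec
    · simp only [τ, dif_neg h, Set.indicator_of_notMem h]
      exact tendsto_const_nhds
  have hτm : Measurable τ :=
    measurable_of_tendsto_metrizable (fun k => (hm (φ k)).indicator hK) (tendsto_pi_nhds.2 hτ)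
  have hτE : τ ∈ E.sections := by
    refine ⟨hτm, fun x => (E.isClosed_fiber x).mem_of_tendsto (hτ x) (Eventually.of_forall ?_)⟩
    intro k
    by_cases h : x ∈ K
    · rw [Set.indicator_of_mem h]; exact (hσ _).2 x
    · rw [Set.indicator_of_notMem h]; exact (E.fiber x).zero_mem
  let v : E.Gamma m := ⟨AEEqFun.mk τ hτm.aestronglyMeasurable, τ, hτE, AEEqFun.coeFn_mk _ _⟩
  have hv : v.1 =ᵐ[m] τ := AEEqFun.coeFn_mk _ _
  refine ⟨v, ?_⟩
  have hlim : ∀ n, Tendsto (fun k => l0Dist (gammaNorm m E (u n - u (φ k))) 0) atTop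
      (𝓝 (l0Dist (gammaNorm m E (u n - v)) 0)) := by
    intro n
    rw [hsub _ _ _ _ (hu' n) hv]
    simp_rw [fun k => hsub _ _ _ _ (hu' n) (hu' (φ k))]
    refine tendsto_integral_of_dominated_convergence (fun _ => (1 : ℝ))
      (fun k => (hint _ _ (hm _) (hm _)).aestronglyMeasurable) (integrable_const _)
      (fun k => ae_of_all _ fun x => ?_) ?_
    · rw [Real.norm_of_nonneg (le_min (norm_nonneg _) zero_le_one)]
      exact min_le_right _ _
    · filter_upwards [hconv] with x hx
      have h5 := hτ x
      simp only [Set.indicator_of_mem (show x ∈ K from hx)] at h5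
      exact ((tendsto_const_nhds.sub h5).norm).min tendsto_const_nhds
  rw [Metric.tendsto_atTop]
  intro ε hε
  obtain ⟨n₀, hn₀⟩ := hu (ε / 2) (by positivity)
  refine ⟨n₀, fun n hn => ?_⟩
  have h6 : l0Dist (gammaNorm m E (u n - v)) 0 ≤ ε / 2 := by
    refine le_of_tendsto (hlim n) ?_
    filter_upwards [eventually_ge_atTop n₀] with k hk
    exact (hn₀ n hn _ (hk.trans (hφ k))).le
  have h7 : 0 ≤ l0Dist (gammaNorm m E (u n - v)) 0 :=
    integral_nonneg fun x => le_min (abs_nonneg _) zero_le_one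
  rw [Real.dist_eq, sub_zero, abs_of_nonneg h7]
  linarith

/-- `Γ(E)` is a normed `L⁰(m)`-module. -/
instance instNormedL0ModuleGamma [SigmaFinite m] [CompleteSpace B] :
    NormedL0Module m (E.Gamma m) where
  pnorm := gammaNorm m E
  pnorm_nonneg s := by
    rw [← AEEqFun.coeFn_le]
    filter_upwards [coeFn_gammaNorm m E s, AEEqFun.coeFn_zero (α := X) (β := ℝ) (μ := m)]
      with x h1 h2
    rw [h1, h2]; exact norm_nonneg _
  pnorm_eq_zero_iff s := by
    constructor
    · intro h
      apply Subtype.ext; apply AEEqFun.ext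
      have h1 := coeFn_gammaNorm m E s
      rw [h] at h1
      filter_upwards [h1, AEEqFun.coeFn_zero (α := X) (β := ℝ) (μ := m),
        AEEqFun.coeFn_zero (α := X) (β := B) (μ := m)] with x h1 h2 h3
      rw [AddSubgroup.coe_zero, h3]
      rw [h2] at h1
      exact norm_eq_zero.1 h1.symm
    · rintro rfl
      apply AEEqFun.ext
      filter_upwards [coeFn_gammaNorm m E 0, AEEqFun.coeFn_zero (α := X) (β := ℝ) (μ := m),
        AEEqFun.coeFn_zero (α := X) (β := B) (μ := m)] with x h1 h2 h3
      rw [h1, h2, AddSubgroup.coe_zero, h3]; simp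
  pnorm_add_le s t := by
    rw [← AEEqFun.coeFn_le]
    filter_upwards [coeFn_gammaNorm m E (s + t), coeFn_gammaNorm m E s, coeFn_gammaNorm m E t,
      AEEqFun.coeFn_add (gammaNorm m E s) (gammaNorm m E t), AEEqFun.coeFn_add s.1 t.1]
      with x h1 h2 h3 h4 h5
    rw [h1, h4, AddSubgroup.coe_add, h5, Pi.add_apply, Pi.add_apply, h2, h3]
    exact norm_add_le _ _
  pnorm_smul f s := by
    apply AEEqFun.ext
    filter_upwards [coeFn_gammaNorm m E (f • s), coeFn_gammaNorm m E s, coeFn_smul m E f s,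
      AEEqFun.coeFn_mul |f| (gammaNorm m E s), AEEqFun.coeFn_abs f] with x h1 h2 h3 h4 h5
    rw [h1, h3, h4, Pi.mul_apply, h5, h2, norm_smul, Real.norm_eq_abs]
  complete := gamma_complete m E

end SeparableBanachBundle

end

/-!
The pointwise norms of rational combinations of countably many generators `vₙ` with `|vₙ| ≤ 1`
give, at almost every point `x`, a seminorm `p x` on the finitely supported rational sequences.
The fibre at `x` should be the associated Banach space; the difficulty is to embed all these
spaces isometrically into `B` in a way that is measurable in `x`.

Since `B` is universal, it is enough to embed into `C(2^ℕ, ℝ)`. The dual unit ball of `p x` is a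
compact subset of `[-1, 1]^ℕ`, a continuous image of the Cantor space; let `A x` be its preimage,
a closed subset of the Cantor space. The `n`-th coordinate functional, composed with a
continuous retraction `nearestPoint (A x)` onto `A x`, is a continuous function `s x n` on the
Cantor space, and Hahn–Banach gives `‖∑ aₙ s x n‖ = p x a`. The retraction sends `t` to the point
minimizing `u ↦ ∑ 3⁻ⁿ |tₙ - uₙ|`; minimizers are unique because ternary expansions with digits
`0` and `1` are, and uniqueness gives both the continuity in `t` and the measurability in `x`
(`continuous_nearestPoint`, `measurable_comp_nearestPoint`). The result is
`exists_stronglyMeasurable_norm_ratComb_eq`.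

The bundle is spanned by the images of the `s x n` in `B`. Both `M` and `Γ(E)` are then
parametrized with dense range by the finitely supported families in `L⁰(m)`, through the `vₙ` and
through the generating sections (`hasDenseRange_generator`). The two parametrizations have
the same pointwise norm on rational families by construction, and on all families because both
norms are Lipschitz in the coefficients (`pnorm_linearCombination_eq`). Completeness extends the
identification to an isomorphism (`isomorphic_of_hasDenseRange`).
-/

/-! ### Nearest points in the Cantor space -/

/-- A distance-like function on the Cantor space: `∑ 3⁻ⁿ` over the indices where the sequences
differ. A point `u` is determined by `t` and by `cantorGap t u`, so nearest points are unique. -/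
noncomputable def cantorGap (t u : ℕ → Bool) : ℝ :=
  Cardinal.cantorFunction (1 / 3) fun n => xor (t n) (u n)

theorem cantorGap_right_injective (t : ℕ → Bool) : Function.Injective (cantorGap t) := by
  intro u v h
  have h1 := Cardinal.cantorFunction_injective (c := 1 / 3) (by norm_num) (by norm_num) h
  funext n
  simpa using congrFun h1 n

theorem continuous_cantorGap : Continuous fun z : (ℕ → Bool) × (ℕ → Bool) => cantorGap z.1 z.2 := by
  unfold cantorGap Cardinal.cantorFunction
  refine continuous_tsum (u := fun n : ℕ => (1 / 3 : ℝ) ^ n) (fun n => ?_)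
    (summable_geometric_of_lt_one (by norm_num) (by norm_num)) fun n z => ?_
  · have h : Continuous fun z : (ℕ → Bool) × (ℕ → Bool) => (z.1 n, z.2 n) := by fun_prop
    exact (continuous_of_discreteTopology (f := fun b : Bool × Bool =>
      cond (xor b.1 b.2) ((1 / 3 : ℝ) ^ n) 0)).comp h
  · unfold Cardinal.cantorFunctionAux
    cases h : xor (z.1 n) (z.2 n) <;> simp [h]

theorem cantorGap_nonneg (t u : ℕ → Bool) : 0 ≤ cantorGap t u :=
  tsum_nonneg fun _ => Cardinal.cantorFunctionAux_nonneg (by norm_num)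

theorem cantorGap_self (t : ℕ → Bool) : cantorGap t t = 0 := by
  simp [cantorGap, Cardinal.cantorFunction, Cardinal.cantorFunctionAux]

theorem exists_minimizer_cantorGap {A : Set (ℕ → Bool)} (hA : IsClosed A) (hne : A.Nonempty)
    (t : ℕ → Bool) : ∃ u ∈ A, ∀ v ∈ A, cantorGap t u ≤ cantorGap t v :=
  hA.isCompact.exists_isMinOn hne
    (continuous_cantorGap.comp (Continuous.prodMk_right t)).continuousOn

open Classical in
/-- The point of `A` nearest to `t` for `cantorGap`; the value is `t` itself if there is none. -/
noncomputable def nearestPoint (A : Set (ℕ → Bool)) (t : ℕ → Bool) : ℕ → Bool :=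
  if h : ∃ u ∈ A, ∀ v ∈ A, cantorGap t u ≤ cantorGap t v then h.choose else t

section

variable {A : Set (ℕ → Bool)}

theorem nearestPoint_spec (hA : IsClosed A) (hne : A.Nonempty) (t : ℕ → Bool) :
    nearestPoint A t ∈ A ∧ ∀ v ∈ A, cantorGap t (nearestPoint A t) ≤ cantorGap t v := by
  have h := exists_minimizer_cantorGap hA hne t
  rw [nearestPoint, dif_pos h]
  exact h.choose_spec

theorem eq_nearestPoint (hA : IsClosed A) {t u : ℕ → Bool} (hu : u ∈ A)
    (hmin : ∀ v ∈ A, cantorGap t u ≤ cantorGap t v) : u = nearestPoint A t := by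
  obtain ⟨h1, h2⟩ := nearestPoint_spec hA ⟨u, hu⟩ t
  exact cantorGap_right_injective t (le_antisymm (hmin _ h1) (h2 _ hu))

theorem nearestPoint_of_mem (hA : IsClosed A) {t : ℕ → Bool} (ht : t ∈ A) :
    nearestPoint A t = t :=
  (eq_nearestPoint hA ht fun v _ => by rw [cantorGap_self]; exact cantorGap_nonneg _ _).symm

theorem continuous_nearestPoint (hA : IsClosed A) (hne : A.Nonempty) :
    Continuous (nearestPoint A) := by
  -- The graph is closed, and the second factor is compact.
  refine continuous_iff_isClosed.2 fun F hF => ?_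
  have hG : IsClosed (Prod.snd ⁻¹' (A ∩ F) ∩
      ⋂ v ∈ A, {z : (ℕ → Bool) × (ℕ → Bool) | cantorGap z.1 z.2 ≤ cantorGap z.1 v}) := by
    refine ((hA.inter hF).preimage continuous_snd).inter ?_
    refine isClosed_biInter fun v _ => isClosed_le continuous_cantorGap ?_
    exact continuous_cantorGap.comp (continuous_fst.prodMk continuous_const)
  convert isClosedMap_fst_of_compactSpace _ hG
  ext t
  constructor
  · intro ht
    obtain ⟨h1, h2⟩ := nearestPoint_spec hA hne t
    exact ⟨(t, _), ⟨⟨h1, ht⟩, Set.mem_iInter₂.2 h2⟩, rfl⟩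
  · rintro ⟨⟨t', u⟩, ⟨⟨h1, h2⟩, h3⟩, rfl⟩
    rw [Set.mem_preimage, ← eq_nearestPoint hA h1 (Set.mem_iInter₂.1 h3)]
    exact h2

/-- Nearest points of a closed-valued correspondence depend measurably on the parameter. -/
theorem measurable_comp_nearestPoint {X : Type*} [MeasurableSpace X] {A : X → Set (ℕ → Bool)}
    (hA : ∀ x, IsClosed (A x)) (hne : ∀ x, (A x).Nonempty)
    (hmeas : ∀ F, IsClosed F → MeasurableSet {x | (A x ∩ F).Nonempty})
    {g : (ℕ → Bool) → ℝ} (hg : Continuous g) (t : ℕ → Bool) :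
    Measurable fun x => g (nearestPoint (A x) t) := by
  have hc : Continuous (cantorGap t) := continuous_cantorGap.comp (Continuous.prodMk_right t)
  have hd : Measurable fun x => cantorGap t (nearestPoint (A x) t) := by
    refine measurable_of_Iic fun r => ?_
    convert hmeas {u | cantorGap t u ≤ r} (isClosed_le hc continuous_const) using 1
    ext x
    obtain ⟨h1, h2⟩ := nearestPoint_spec (hA x) (hne x) t
    exact ⟨fun h => ⟨_, h1, h⟩, fun ⟨u, hu, hr⟩ => (h2 u hu).trans hr⟩
  refine measurable_of_Iic fun a => ?_
  have hF : IsClosed {u | g u ≤ a} := isClosed_le hg continuous_const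
  -- The nearest point lies in the closed set `F` iff `A x ∩ F` contains points at every rational
  -- gap exceeding the minimal one.
  have key : (fun x => g (nearestPoint (A x) t)) ⁻¹' Set.Iic a = ⋂ r : ℚ,
      {x | cantorGap t (nearestPoint (A x) t) < r → x ∈
        {x | (A x ∩ ({u | g u ≤ a} ∩ {u | cantorGap t u ≤ r})).Nonempty}} := by
    ext x
    obtain ⟨h1, h2⟩ := nearestPoint_spec (hA x) (hne x) t
    simp only [Set.mem_preimage, Set.mem_Iic, Set.mem_iInter]
    refine ⟨fun h r hr => ⟨_, h1, h, hr.le⟩, fun h => ?_⟩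
    have hAF : (A x ∩ {u | g u ≤ a}).Nonempty := by
      obtain ⟨r, hr⟩ := exists_rat_gt (cantorGap t (nearestPoint (A x) t))
      obtain ⟨u, hu, hu', -⟩ := h r hr
      exact ⟨u, hu, hu'⟩
    obtain ⟨h3, h4⟩ := nearestPoint_spec ((hA x).inter hF) hAF t
    have h5 : nearestPoint (A x ∩ {u | g u ≤ a}) t = nearestPoint (A x) t := by
      refine cantorGap_right_injective t (le_antisymm (le_of_forall_lt_rat_imp_le ?_) (h2 _ h3.1))
      intro r hr
      obtain ⟨u, hu, hu', hur⟩ := h r hr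
      exact (h4 u ⟨hu, hu'⟩).trans hur
    rw [← h5]
    exact h3.2
  rw [key]
  refine MeasurableSet.iInter fun r => ?_
  exact (measurableSet_lt hd measurable_const).imp
    (hmeas _ (hF.inter (isClosed_le hc continuous_const)))

end

/-! ### Seminorms with rational coefficients and their norming functionals -/

/-- The linear combination `∑ aₙ φₙ` with rational coefficients in a real vector space. -/
noncomputable def ratComb {V : Type*} [AddCommGroup V] [Module ℝ V] (φ : ℕ → V) (a : ℕ →₀ ℚ) : V :=
  a.sum fun n r => (r : ℝ) • φ n

/-- The finitely supported real sequence with the same coefficients. -/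
noncomputable def ratToReal : (ℕ →₀ ℚ) →+ (ℕ →₀ ℝ) :=
  Finsupp.mapRange.addMonoidHom (Rat.castHom ℝ).toAddMonoidHom

@[simp] theorem ratToReal_apply (a : ℕ →₀ ℚ) (n : ℕ) : ratToReal a n = a n := by
  simp [ratToReal]

theorem ratToReal_smul (r : ℚ) (a : ℕ →₀ ℚ) : ratToReal (r • a) = (r : ℝ) • ratToReal a := by
  ext n; simp

theorem linearCombination_ratToReal {V : Type*} [AddCommGroup V] [Module ℝ V] (φ : ℕ → V)
    (a : ℕ →₀ ℚ) : Finsupp.linearCombination ℝ φ (ratToReal a) = ratComb φ a := by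
  rw [Finsupp.linearCombination_apply]
  exact Finsupp.sum_mapRange_index (hf := Rat.cast_zero) fun n => zero_smul ℝ (φ n)

theorem ratComb_add {V : Type*} [AddCommGroup V] [Module ℝ V] (φ : ℕ → V) (a b : ℕ →₀ ℚ) :
    ratComb φ (a + b) = ratComb φ a + ratComb φ b := by
  simp only [← linearCombination_ratToReal, map_add]

theorem map_ratComb {V W F : Type*} [AddCommGroup V] [Module ℝ V] [AddCommGroup W] [Module ℝ W]
    [FunLike F V W] [LinearMapClass F ℝ V W] (f : F) (φ : ℕ → V) (a : ℕ →₀ ℚ) :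
    f (ratComb φ a) = ratComb (fun n => f (φ n)) a := by
  simp [ratComb, Finsupp.sum, map_sum, map_smul]

/-- The `ℓ¹`-norm of a finitely supported sequence. -/
noncomputable def l1Norm (d : ℕ →₀ ℝ) : ℝ := d.sum fun _ r => |r|

theorem l1Norm_eq_sum {d : ℕ →₀ ℝ} {s : Finset ℕ} (h : d.support ⊆ s) :
    l1Norm d = ∑ n ∈ s, |d n| :=
  Finsupp.sum_of_support_subset _ h _ fun _ _ => abs_zero

theorem l1Norm_nonneg (d : ℕ →₀ ℝ) : 0 ≤ l1Norm d := Finset.sum_nonneg fun _ _ => abs_nonneg _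

@[simp] theorem l1Norm_zero : l1Norm 0 = 0 := by simp [l1Norm]

theorem l1Norm_add_le (d e : ℕ →₀ ℝ) : l1Norm (d + e) ≤ l1Norm d + l1Norm e := by
  classical
  rw [l1Norm_eq_sum (s := d.support ∪ e.support) Finsupp.support_add,
    l1Norm_eq_sum (s := d.support ∪ e.support) Finset.subset_union_left,
    l1Norm_eq_sum (s := d.support ∪ e.support) Finset.subset_union_right,
    ← Finset.sum_add_distrib]
  exact Finset.sum_le_sum fun n _ => abs_add_le _ _

theorem l1Norm_smul (c : ℝ) (d : ℕ →₀ ℝ) : l1Norm (c • d) = |c| * l1Norm d := by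
  rw [l1Norm_eq_sum (s := d.support) Finsupp.support_smul, l1Norm, Finsupp.sum, Finset.mul_sum]
  simp [abs_mul]

/-- Every finitely supported real sequence is an `ℓ¹`-limit of rational ones. -/
theorem exists_rat_l1Norm_sub_lt (d : ℕ →₀ ℝ) {ε : ℝ} (hε : 0 < ε) :
    ∃ b : ℕ →₀ ℚ, l1Norm (d - ratToReal b) < ε := by
  induction d using Finsupp.induction_linear generalizing ε with
  | zero => exact ⟨0, by simpa using hε⟩
  | add d e hd he =>
    obtain ⟨b, hb⟩ := hd (half_pos hε)
    obtain ⟨c, hc⟩ := he (half_pos hε)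
    refine ⟨b + c, ?_⟩
    rw [map_add, add_sub_add_comm]
    linarith [l1Norm_add_le (d - ratToReal b) (e - ratToReal c)]
  | single n r =>
    obtain ⟨q, hq⟩ := exists_rat_btwn (sub_lt_self r hε)
    refine ⟨Finsupp.single n q, ?_⟩
    have h : Finsupp.single n r - ratToReal (Finsupp.single n q) = Finsupp.single n (r - q) := by
      ext k
      rw [Finsupp.sub_apply, ratToReal_apply, Finsupp.single_apply, Finsupp.single_apply,
        Finsupp.single_apply]
      split_ifs <;> simp
    rw [h, l1Norm, Finsupp.sum_single_index (by simp), abs_lt]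
    constructor <;> linarith [hq.1, hq.2]

/-- Seminorms on the finitely supported rational sequences which are at most `1` on the
standard unit vectors. -/
structure IsRatSeminorm (p : (ℕ →₀ ℚ) → ℝ) : Prop where
  add_le : ∀ a b, p (a + b) ≤ p a + p b
  smul_eq : ∀ (r : ℚ) a, p (r • a) = |(r : ℝ)| * p a
  single_le : ∀ n, p (Finsupp.single n 1) ≤ 1

namespace IsRatSeminorm

variable {p : (ℕ →₀ ℚ) → ℝ} (hp : IsRatSeminorm p)
include hp

theorem map_zero : p 0 = 0 := by simpa using hp.smul_eq 0 0

theorem map_neg (a : ℕ →₀ ℚ) : p (-a) = p a := by simpa using hp.smul_eq (-1) a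

theorem nonneg (a : ℕ →₀ ℚ) : 0 ≤ p a := by
  have h := hp.add_le a (-a)
  rw [add_neg_cancel, hp.map_zero, hp.map_neg] at h
  linarith

theorem le_l1Norm (a : ℕ →₀ ℚ) : p a ≤ l1Norm (ratToReal a) := by
  classical
  rw [l1Norm_eq_sum (s := a.support) 
    (fun n hn => by simpa using hn)]
  conv_lhs => rw [← Finsupp.sum_single a, Finsupp.sum]
  have h := Finset.le_sum_of_subadditive p hp.map_zero.le hp.add_le a.support
    fun n => Finsupp.single n (a n)
  refine h.trans (Finset.sum_le_sum fun n _ => ?_)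
  have h2 : Finsupp.single n (a n) = a n • Finsupp.single n (1 : ℚ) := by simp
  rw [h2, hp.smul_eq, ratToReal_apply]
  exact mul_le_of_le_one_right (abs_nonneg _) (hp.single_le n)

omit hp in
/-- The largest extension of `p` to real coefficients which is `1`-Lipschitz for the
`ℓ¹`-norm. -/
noncomputable def extend (p : (ℕ →₀ ℚ) → ℝ) (d : ℕ →₀ ℝ) : ℝ :=
  ⨅ b : ℕ →₀ ℚ, (p b + l1Norm (d - ratToReal b))

theorem bddBelow (d : ℕ →₀ ℝ) :
    BddBelow (Set.range fun b : ℕ →₀ ℚ => p b + l1Norm (d - ratToReal b)) :=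
  ⟨0, by rintro _ ⟨b, rfl⟩; exact add_nonneg (hp.nonneg b) (l1Norm_nonneg _)⟩

theorem extend_le (d : ℕ →₀ ℝ) (b : ℕ →₀ ℚ) : extend p d ≤ p b + l1Norm (d - ratToReal b) :=
  ciInf_le (hp.bddBelow d) b

theorem extend_nonneg (d : ℕ →₀ ℝ) : 0 ≤ extend p d :=
  le_ciInf fun b => add_nonneg (hp.nonneg b) (l1Norm_nonneg _)

theorem extend_ratToReal (a : ℕ →₀ ℚ) : extend p (ratToReal a) = p a := by
  refine le_antisymm (by simpa using hp.extend_le (ratToReal a) a) (le_ciInf fun b => ?_)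
  have h := hp.add_le b (a - b)
  rw [add_sub_cancel] at h
  have h2 := hp.le_l1Norm (a - b)
  rw [map_sub] at h2
  linarith

theorem extend_add_le (d e : ℕ →₀ ℝ) : extend p (d + e) ≤ extend p d + extend p e := by
  refine le_ciInf_add_ciInf fun b c => ?_
  have h := hp.extend_le (d + e) (b + c)
  rw [map_add, add_sub_add_comm] at h
  linarith [l1Norm_add_le (d - ratToReal b) (e - ratToReal c), hp.add_le b c]

theorem extend_smul_le {c : ℝ} (hc : 0 < c) (d : ℕ →₀ ℝ) : extend p (c • d) ≤ c * extend p d := by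
  rw [extend, extend, Real.mul_iInf_of_nonneg hc.le]
  refine le_ciInf fun b => le_of_forall_pos_le_add fun ε hε => ?_
  -- Replace the scalar `c` by a nearby rational.
  have hK : 0 < p b + l1Norm (ratToReal b) + 1 := by
    linarith [hp.nonneg b, l1Norm_nonneg (ratToReal b)]
  obtain ⟨r, hr1, hr2⟩ := exists_rat_btwn (lt_add_of_pos_right c (div_pos hε hK))
  have h := hp.extend_le (c • d) (r • b)
  have hsplit : c • d - ratToReal (r • b) = c • (d - ratToReal b) + (c - r) • ratToReal b := by
    rw [ratToReal_smul, smul_sub, sub_smul]; abel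
  have h2 := l1Norm_add_le (c • (d - ratToReal b)) ((c - r) • ratToReal b)
  rw [l1Norm_smul, l1Norm_smul, abs_of_pos hc, abs_of_neg (by linarith : c - r < 0)] at h2
  rw [hsplit, hp.smul_eq, abs_of_pos (by linarith)] at h
  have h3 : (r - c) * (p b + l1Norm (ratToReal b) + 1) ≤ ε := by
    rw [← le_div_iff₀ hK]; linarith
  change extend p (c • d) ≤ _
  nlinarith [hp.nonneg b, l1Norm_nonneg (ratToReal b)]

theorem extend_smul {c : ℝ} (hc : 0 < c) (d : ℕ →₀ ℝ) : extend p (c • d) = c * extend p d := by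
  refine le_antisymm (hp.extend_smul_le hc d) ?_
  have h := hp.extend_smul_le (inv_pos.2 hc) (c • d)
  rw [inv_smul_smul₀ hc.ne'] at h
  rwa [← le_inv_mul_iff₀ hc]

/-- Hahn–Banach: the value of `p` at a rational vector is attained by a functional
dominated by `p`. -/
theorem exists_norming (a : ℕ →₀ ℚ) :
    ∃ φ : ℕ → ℝ, (∀ b, |ratComb φ b| ≤ p b) ∧ ratComb φ a = p a := by
  rcases eq_or_ne a 0 with rfl | ha
  · refine ⟨0, fun b => ?_, ?_⟩
    · simpa [ratComb] using hp.nonneg b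
    · simp [ratComb, hp.map_zero]
  have ha' : ratToReal a ≠ 0 := fun h => ha <| by
    ext n
    simpa using DFunLike.congr_fun h n
  obtain ⟨g, hg1, hg2⟩ := exists_extension_of_le_sublinear
    (LinearPMap.mkSpanSingleton (ratToReal a) (p a) ha') (extend p)
    (fun c hc d => hp.extend_smul hc d) hp.extend_add_le (by
      rintro ⟨d, hd⟩
      obtain ⟨c, rfl⟩ := Submodule.mem_span_singleton.1 hd
      refine (LinearPMap.mkSpanSingleton'_apply ..).trans_le ?_
      rw [RingHom.id_apply, smul_eq_mul]
      rcases le_or_gt c 0 with hc | hc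
      · exact (mul_nonpos_of_nonpos_of_nonneg hc (hp.nonneg a)).trans (hp.extend_nonneg _)
      · change _ ≤ extend p (c • ratToReal a)
        rw [hp.extend_smul hc, hp.extend_ratToReal])
  have hcomb : ∀ b, ratComb (fun n => g (Finsupp.single n 1)) b = g (ratToReal b) := fun b => by
    rw [← map_ratComb, ← linearCombination_ratToReal]
    congr 1
    simp [Finsupp.linearCombination_apply]
  have hle : ∀ b, g (ratToReal b) ≤ p b := fun b => by
    rw [← hp.extend_ratToReal b]; exact hg2 _
  refine ⟨fun n => g (Finsupp.single n 1), fun b => ?_, ?_⟩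
  · rw [hcomb, abs_le]
    have h := hle (-b)
    rw [_root_.map_neg, _root_.map_neg, hp.map_neg] at h
    exact ⟨by linarith, hle b⟩
  · rw [hcomb]
    have h := hg1 ⟨ratToReal a, Submodule.mem_span_singleton_self _⟩
    rw [h]
    exact LinearPMap.mkSpanSingleton_apply ..

end IsRatSeminorm

/-! ### Measurable isometric representation in `C(2^ℕ, ℝ)` -/

section

variable {Y : Type*}

/-- A continuous surjection of the Cantor space onto `[-1, 1]^ℕ`. -/
theorem exists_cantor_surjective_cube : ∃ π : (ℕ → Bool) → ℕ → ℝ, Continuous π ∧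
    ∀ φ : ℕ → ℝ, (∀ n, |φ n| ≤ 1) → ∃ t, π t = φ := by
  let : MetricSpace (ℕ → Set.Icc (-1 : ℝ) 1) := TopologicalSpace.metrizableSpaceMetric _
  have : Nonempty (Set.Icc (-1 : ℝ) 1) := ⟨⟨0, by norm_num⟩⟩
  obtain ⟨f, hf, hsurj⟩ := exists_nat_bool_continuous_surjective_of_compact
    (ℕ → Set.Icc (-1 : ℝ) 1)
  refine ⟨fun t n => f t n, by fun_prop, fun φ hφ => ?_⟩
  obtain ⟨t, ht⟩ := hsurj fun n => ⟨φ n, abs_le.1 (hφ n)⟩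
  exact ⟨t, by funext n; simp only [ht]⟩

/-- The parameters of the sequences `φ` which, as functionals, are dominated by `p`. -/
def dualBallCode (π : Y → ℕ → ℝ) (p : (ℕ →₀ ℚ) → ℝ) : Set Y :=
  ⋂ a : ℕ →₀ ℚ, {t | |ratComb (π t) a| ≤ p a}

theorem mem_dualBallCode {π : Y → ℕ → ℝ} {p : (ℕ →₀ ℚ) → ℝ} {t : Y} :
    t ∈ dualBallCode π p ↔ ∀ a, |ratComb (π t) a| ≤ p a := Set.mem_iInter

theorem continuous_ratComb [TopologicalSpace Y] {V : Type*} [AddCommGroup V] [Module ℝ V]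
    [TopologicalSpace V] [ContinuousAdd V] [ContinuousConstSMul ℝ V] {π : Y → ℕ → V}
    (hπ : ∀ n, Continuous fun t => π t n) (a : ℕ →₀ ℚ) : Continuous fun t => ratComb (π t) a :=
  continuous_finsetSum _ fun n _ => (hπ n).const_smul _

theorem isClosed_dualBallCode [TopologicalSpace Y] {π : Y → ℕ → ℝ} (hπ : Continuous π)
    (p : (ℕ →₀ ℚ) → ℝ) : IsClosed (dualBallCode π p) :=
  isClosed_iInter fun a => isClosed_le
    (continuous_ratComb (fun n => (continuous_apply n).comp hπ) a).abs continuous_const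

theorem IsRatSeminorm.exists_mem_dualBallCode {π : Y → ℕ → ℝ}
    (hsurj : ∀ φ : ℕ → ℝ, (∀ n, |φ n| ≤ 1) → ∃ t, π t = φ) {p : (ℕ →₀ ℚ) → ℝ}
    (hp : IsRatSeminorm p) (a : ℕ →₀ ℚ) : ∃ t ∈ dualBallCode π p, ratComb (π t) a = p a := by
  obtain ⟨φ, hφ, hφa⟩ := hp.exists_norming a
  obtain ⟨t, rfl⟩ := hsurj φ fun n => by
    have h := (hφ (Finsupp.single n 1)).trans (hp.single_le n)
    simpa [ratComb] using h
  exact ⟨t, mem_dualBallCode.2 hφ, hφa⟩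

/-- Whether the dual unit ball of `p` meets a closed set is a closed condition on `p`, by
compactness; this gives the measurability of the correspondence. -/
theorem measurableSet_dualBallCode_inter {X : Type*} [MeasurableSpace X] [TopologicalSpace Y]
    [CompactSpace Y] {π : Y → ℕ → ℝ} (hπ : Continuous π) {p : X → (ℕ →₀ ℚ) → ℝ}
    (hm : ∀ a, Measurable fun x => p x a) {F : Set Y} (hF : IsClosed F) :
    MeasurableSet {x | (dualBallCode π (p x) ∩ F).Nonempty} := by
  have hG : IsClosed ((⋂ a : ℕ →₀ ℚ, {z : Y × ((ℕ →₀ ℚ) → ℝ) | |ratComb (π z.1) a| ≤ z.2 a}) ∩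
      Prod.fst ⁻¹' F) := by
    refine (isClosed_iInter fun a => isClosed_le ?_ (by fun_prop)).inter
      (hF.preimage continuous_fst)
    exact ((continuous_ratComb (fun n => (continuous_apply n).comp hπ) a).comp continuous_fst).abs
  have hS := (isClosedMap_snd_of_compactSpace _ hG).measurableSet
  convert (measurable_pi_lambda p hm) hS using 1
  ext x
  constructor
  · rintro ⟨t, ht, htF⟩
    exact ⟨(t, p x), ⟨Set.mem_iInter.2 (mem_dualBallCode.1 ht), htF⟩, rfl⟩
  · rintro ⟨⟨t, q⟩, ⟨ht, htF⟩, hq⟩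
    obtain rfl : q = p x := hq
    exact ⟨t, mem_dualBallCode.2 (Set.mem_iInter.1 ht), htF⟩

/-- Measurability into `C(K, ℝ)` can be tested on point evaluations. -/
theorem stronglyMeasurable_of_eval {X K : Type*} [MeasurableSpace X] [TopologicalSpace K]
    [CompactSpace K] [TopologicalSpace.MetrizableSpace K] [Nonempty K] {f : X → C(K, ℝ)}
    (hf : ∀ t, Measurable fun x => f x t) : StronglyMeasurable f := by
  let : MeasurableSpace C(K, ℝ) := borel _
  have : BorelSpace C(K, ℝ) := ⟨rfl⟩
  let : MetricSpace K := TopologicalSpace.metrizableSpaceMetric K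
  have hc : Continuous fun (g : C(K, ℝ)) (k : ℕ) => g (TopologicalSpace.denseSeq K k) := by
    fun_prop
  have hinj : Function.Injective
      fun (g : C(K, ℝ)) (k : ℕ) => g (TopologicalSpace.denseSeq K k) := fun g h hgh =>
    DFunLike.coe_injective <| g.continuous.ext_on (TopologicalSpace.denseRange_denseSeq K)
      h.continuous fun _ ⟨k, hk⟩ => hk ▸ congrFun hgh k
  -- An injective continuous map between Polish spaces is a measurable embedding.
  exact ((hc.measurableEmbedding hinj).measurable_comp_iff.1
    (measurable_pi_lambda _ fun k => hf _)).stronglyMeasurable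

/-- A measurable family of seminorms on the finitely supported rational sequences is realised
by the norms of linear combinations of measurable maps into `C(2^ℕ, ℝ)`. -/
theorem exists_stronglyMeasurable_norm_ratComb_eq {X : Type*} [MeasurableSpace X]
    {p : X → (ℕ →₀ ℚ) → ℝ} (hp : ∀ x, IsRatSeminorm (p x)) (hm : ∀ a, Measurable fun x => p x a) :
    ∃ s : X → ℕ → C(ℕ → Bool, ℝ), (∀ n, StronglyMeasurable fun x => s x n) ∧
      ∀ x a, ‖ratComb (s x) a‖ = p x a := by
  obtain ⟨π, hπ, hsurj⟩ := exists_cantor_surjective_cube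
  have hcl := fun x => isClosed_dualBallCode hπ (p x)
  have hne : ∀ x, (dualBallCode π (p x)).Nonempty := fun x =>
    let ⟨t, ht, _⟩ := (hp x).exists_mem_dualBallCode hsurj 0
    ⟨t, ht⟩
  refine ⟨fun x n => ⟨fun t => π (nearestPoint (dualBallCode π (p x)) t) n,
    ((continuous_apply n).comp hπ).comp (continuous_nearestPoint (hcl x) (hne x))⟩,
    fun n => stronglyMeasurable_of_eval fun t => ?_, fun x a => ?_⟩
  · exact measurable_comp_nearestPoint hcl hne
      (fun F hF => measurableSet_dualBallCode_inter hπ hm hF) ((continuous_apply n).comp hπ) t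
  · have heval : ∀ t, ratComb (fun n => (⟨fun t => π (nearestPoint (dualBallCode π (p x)) t) n,
        ((continuous_apply n).comp hπ).comp (continuous_nearestPoint (hcl x) (hne x))⟩ :
          C(ℕ → Bool, ℝ))) a t = ratComb (π (nearestPoint (dualBallCode π (p x)) t)) a := by
      intro t
      simp [ratComb, Finsupp.sum]
    refine le_antisymm ((ContinuousMap.norm_le _ ((hp x).nonneg a)).2 fun t => ?_) ?_
    · rw [heval, Real.norm_eq_abs]
      exact mem_dualBallCode.1 (nearestPoint_spec (hcl x) (hne x) t).1 a
    · obtain ⟨t, ht, hta⟩ := (hp x).exists_mem_dualBallCode hsurj a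
      have h := ContinuousMap.norm_coe_le_norm (ratComb (fun n =>
        (⟨fun t => π (nearestPoint (dualBallCode π (p x)) t) n, ((continuous_apply n).comp hπ).comp
          (continuous_nearestPoint (hcl x) (hne x))⟩ : C(ℕ → Bool, ℝ))) a) t
      rw [heval, nearestPoint_of_mem (hcl x) ht, hta] at h
      exact (le_abs_self _).trans h

end

/-! ### Convergence in `L⁰(m)` -/

section

variable {X : Type*} [MeasurableSpace X] {m : Measure X} [SigmaFinite m]

theorem integrable_min_abs_one (f : X →ₘ[m] ℝ) :
    Integrable (fun x => min |f x - (0 : X →ₘ[m] ℝ) x| 1) m.toFinite := by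
  refine Integrable.of_bound (C := 1) (((f.measurable.sub
    (0 : X →ₘ[m] ℝ).measurable).abs).min measurable_const).aestronglyMeasurable
    (ae_of_all _ fun x => ?_)
  rw [Real.norm_of_nonneg (le_min (abs_nonneg _) zero_le_one)]
  exact min_le_right _ _

theorem l0Dist_nonneg (f g : X →ₘ[m] ℝ) : 0 ≤ l0Dist f g :=
  integral_nonneg fun _ => le_min (abs_nonneg _) zero_le_one

theorem ae_toFinite_of_ae {P : X → Prop} (h : ∀ᵐ x ∂m, P x) : ∀ᵐ x ∂m.toFinite, P x := by
  rwa [ae_toFinite]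

theorem l0Dist_zero_le_add {f g h : X →ₘ[m] ℝ} (hle : ∀ᵐ x ∂m, |f x| ≤ |g x| + |h x|) :
    l0Dist f 0 ≤ l0Dist g 0 + l0Dist h 0 := by
  unfold l0Dist
  rw [← integral_add (integrable_min_abs_one g) (integrable_min_abs_one h)]
  refine integral_mono_ae (integrable_min_abs_one f)
    ((integrable_min_abs_one g).add (integrable_min_abs_one h)) (ae_toFinite_of_ae ?_)
  filter_upwards [hle, AEEqFun.coeFn_zero (α := X) (β := ℝ) (μ := m)] with x hx h0
  simp only [h0, Pi.zero_apply, sub_zero]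
  have h1 := abs_nonneg (g x)
  have h2 := abs_nonneg (h x)
  rcases min_cases |g x| 1 with ⟨ha, _⟩ | ⟨ha, _⟩ <;>
    rcases min_cases |h x| 1 with ⟨hb, _⟩ | ⟨hb, _⟩ <;> rw [ha, hb]
  · exact (min_le_left _ _).trans hx
  all_goals exact (min_le_right _ _).trans (by linarith)

theorem tendsto_l0Dist_of_ae {f : ℕ → X →ₘ[m] ℝ}
    (h : ∀ᵐ x ∂m, Tendsto (fun n => f n x) atTop (𝓝 0)) :
    Tendsto (fun n => l0Dist (f n) 0) atTop (𝓝 0) := by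
  have h1 := tendsto_integral_of_dominated_convergence (μ := m.toFinite)
    (F := fun n x => min |f n x - (0 : X →ₘ[m] ℝ) x| 1) (f := fun _ => 0) (fun _ => (1 : ℝ))
    (fun n => (integrable_min_abs_one (f n)).aestronglyMeasurable) (integrable_const _)
    (fun n => ae_of_all _ fun x => by
      rw [Real.norm_of_nonneg (le_min (abs_nonneg _) zero_le_one)]
      exact min_le_right _ _) (ae_toFinite_of_ae ?_)
  · rw [integral_zero] at h1
    exact h1
  · filter_upwards [h, AEEqFun.coeFn_zero (α := X) (β := ℝ) (μ := m)] with x hx h0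
    simpa [h0] using hx.abs.min (tendsto_const_nhds (x := (1 : ℝ)))

theorem exists_subseq_ae_of_tendsto_l0Dist {f : ℕ → X →ₘ[m] ℝ}
    (h : Tendsto (fun n => l0Dist (f n) 0) atTop (𝓝 0)) :
    ∃ φ : ℕ → ℕ, StrictMono φ ∧ ∀ᵐ x ∂m, Tendsto (fun k => f (φ k) x) atTop (𝓝 0) := by
  have h1 : TendstoInMeasure m.toFinite (fun n x => min |f n x - (0 : X →ₘ[m] ℝ) x| 1) atTop
      fun _ => 0 := by
    refine tendstoInMeasure_of_tendsto_eLpNorm one_ne_zero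
      (fun n => (integrable_min_abs_one (f n)).aestronglyMeasurable)
      aestronglyMeasurable_const ?_
    have h2 := (ENNReal.continuous_ofReal.tendsto 0).comp h
    rw [ENNReal.ofReal_zero] at h2
    refine h2.congr fun n => ?_
    rw [eLpNorm_one_eq_lintegral_enorm, Function.comp, l0Dist,
      ofReal_integral_eq_lintegral_ofReal (integrable_min_abs_one (f n))
        (ae_of_all _ fun x => le_min (abs_nonneg _) zero_le_one)]
    refine lintegral_congr fun x => ?_
    rw [Pi.sub_apply, sub_zero, Real.enorm_of_nonneg (le_min (abs_nonneg _) zero_le_one)]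
  obtain ⟨φ, hφ, hae⟩ := h1.exists_seq_tendsto_ae
  refine ⟨φ, hφ, ?_⟩
  rw [ae_toFinite] at hae
  filter_upwards [hae, AEEqFun.coeFn_zero (α := X) (β := ℝ) (μ := m)] with x hx h0
  simp only [h0, Pi.zero_apply, sub_zero] at hx
  refine (tendsto_zero_iff_abs_tendsto_zero _).2 ?_
  refine hx.congr' ?_
  filter_upwards [hx.eventually (gt_mem_nhds zero_lt_one)] with k hk
  exact min_eq_left ((min_lt_iff.1 hk).resolve_right (lt_irrefl _)).le

end

/-! ### Rational constants in `L⁰(m)` -/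

section

variable {X : Type*} [MeasurableSpace X] {m : Measure X}

/-- The embedding of rational constants in `L⁰(m)`. -/
noncomputable def ratConst (m : Measure X) : ℚ →+ (X →ₘ[m] ℝ) where
  toFun q := AEEqFun.const X (q : ℝ)
  map_zero' := by rw [Rat.cast_zero]; rfl
  map_add' q r := by rw [Rat.cast_add]; rfl

theorem coeFn_ratConst (q : ℚ) : ∀ᵐ x ∂m, ratConst m q x = q := AEEqFun.coeFn_const X (q : ℝ)

/-- Finitely supported families of rational constants in `L⁰(m)`. -/
noncomputable def ratFamily (m : Measure X) : (ℕ →₀ ℚ) →+ (ℕ →₀ (X →ₘ[m] ℝ)) :=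
  Finsupp.mapRange.addMonoidHom (ratConst m)

theorem ratFamily_apply (a : ℕ →₀ ℚ) (n : ℕ) : ratFamily m a n = ratConst m (a n) := rfl

theorem ratFamily_smul (r : ℚ) (a : ℕ →₀ ℚ) :
    ratFamily m (r • a) = ratConst m r • ratFamily m a := by
  ext1 n
  apply AEEqFun.ext
  rw [Finsupp.smul_apply, ratFamily_apply, ratFamily_apply, Finsupp.smul_apply, smul_eq_mul,
    smul_eq_mul]
  filter_upwards [coeFn_ratConst (m := m) (r * a n), coeFn_ratConst (m := m) r,
    coeFn_ratConst (m := m) (a n), AEEqFun.coeFn_mul (ratConst m r) (ratConst m (a n))]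
    with x h1 h2 h3 h4
  rw [h1, h4, Pi.mul_apply, h2, h3, Rat.cast_mul]

theorem ratFamily_single (n : ℕ) (r : ℚ) :
    ratFamily m (Finsupp.single n r) = Finsupp.single n (ratConst m r) :=
  Finsupp.mapRange_single (hf := (ratConst m).map_zero)

theorem ratConst_one : ratConst m 1 = 1 := by
  change AEEqFun.const X ((1 : ℚ) : ℝ) = 1
  rw [Rat.cast_one]; rfl

end

/-! ### Pointwise norms almost everywhere -/

namespace NormedL0Module

variable {X : Type*} [MeasurableSpace X] {m : Measure X} [SigmaFinite m]
  {M : Type*} [AddCommGroup M] [Module (X →ₘ[m] ℝ) M] [NormedL0Module m M]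

theorem pnorm_zero : pnorm (m := m) (0 : M) = 0 := (pnorm_eq_zero_iff _).2 rfl

theorem pnorm_nonneg_ae (v : M) : ∀ᵐ x ∂m, 0 ≤ pnorm (m := m) v x := by
  filter_upwards [AEEqFun.coeFn_le.2 (pnorm_nonneg (m := m) v),
    AEEqFun.coeFn_zero (α := X) (β := ℝ) (μ := m)] with x h h0
  simpa [h0] using h

theorem pnorm_smul_ae (f : X →ₘ[m] ℝ) (v : M) :
    ∀ᵐ x ∂m, pnorm (m := m) (f • v) x = |f x| * pnorm (m := m) v x := by
  rw [pnorm_smul]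
  filter_upwards [AEEqFun.coeFn_mul |f| (pnorm (m := m) v), AEEqFun.coeFn_abs f] with x h1 h2
  rw [h1, Pi.mul_apply, h2]

theorem pnorm_add_le_ae (v w : M) :
    ∀ᵐ x ∂m, pnorm (m := m) (v + w) x ≤ pnorm (m := m) v x + pnorm (m := m) w x := by
  filter_upwards [AEEqFun.coeFn_le.2 (pnorm_add_le (m := m) v w),
    AEEqFun.coeFn_add (pnorm (m := m) v) (pnorm (m := m) w)] with x h1 h2
  rwa [h2] at h1

theorem pnorm_neg (v : M) : pnorm (m := m) (-v) = pnorm (m := m) v := by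
  rw [← neg_one_smul (X →ₘ[m] ℝ) v, pnorm_smul, abs_neg]
  have h : |(1 : X →ₘ[m] ℝ)| = 1 := by
    apply AEEqFun.ext
    filter_upwards [AEEqFun.coeFn_abs (1 : X →ₘ[m] ℝ),
      AEEqFun.coeFn_one (α := X) (β := ℝ) (μ := m)] with x h1 h2
    rw [h1, h2]; simp
  rw [h, one_mul]

theorem pnorm_sub_comm (v w : M) : pnorm (m := m) (v - w) = pnorm (m := m) (w - v) := by
  rw [← neg_sub, pnorm_neg]

/-- The triangle inequality through an intermediate point. -/
theorem pnorm_sub_le_ae (u v w : M) : ∀ᵐ x ∂m,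
    pnorm (m := m) (u - w) x ≤ pnorm (m := m) (u - v) x + pnorm (m := m) (v - w) x := by
  have h := pnorm_add_le_ae (m := m) (u - v) (v - w)
  rwa [sub_add_sub_cancel] at h

theorem abs_pnorm_sub_pnorm_le_ae (v w : M) : ∀ᵐ x ∂m,
    |pnorm (m := m) v x - pnorm (m := m) w x| ≤ pnorm (m := m) (v - w) x := by
  have h1 := pnorm_add_le_ae (m := m) (v - w) w
  have h2 := pnorm_add_le_ae (m := m) (w - v) v
  rw [sub_add_cancel] at h1 h2
  rw [pnorm_sub_comm] at h2
  filter_upwards [h1, h2] with x h1 h2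
  rw [abs_le]; constructor <;> linarith

theorem eq_zero_of_pnorm_ae {v : M} (h : ∀ᵐ x ∂m, pnorm (m := m) v x = 0) : v = 0 := by
  rw [← pnorm_eq_zero_iff (m := m)]
  apply AEEqFun.ext
  filter_upwards [h, AEEqFun.coeFn_zero (α := X) (β := ℝ) (μ := m)] with x h1 h2
  rw [h1, h2, Pi.zero_apply]

/-! ### Isomorphisms from isometric dense parametrizations -/

/-- The range of `A` is dense for the distance of the normed module. -/
def HasDenseRange {D : Type*} (m : Measure X) [SigmaFinite m] {M : Type*} [AddCommGroup M]
    [Module (X →ₘ[m] ℝ) M] [NormedL0Module m M] (A : D → M) : Prop :=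
  ∀ v : M, ∀ ε : ℝ, 0 < ε → ∃ d, moduleDist m v (A d) < ε

theorem HasDenseRange.exists_seq {D : Type*} {A : D → M} (hA : HasDenseRange m A) (v : M) :
    ∃ d : ℕ → D, Tendsto (fun k => l0Dist (pnorm (m := m) (v - A (d k))) 0) atTop (𝓝 0) := by
  choose d hd using fun k : ℕ => hA v (1 / ((k : ℝ) + 1)) (by positivity)
  exact ⟨d, squeeze_zero (fun k => l0Dist_nonneg _ _) (fun k => (hd k).le)
    tendsto_one_div_add_atTop_nhds_zero_nat⟩

theorem HasDenseRange.exists_seq_ae {D : Type*} {A : D → M} (hA : HasDenseRange m A) (v : M) :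
    ∃ d : ℕ → D, ∀ᵐ x ∂m, Tendsto (fun k => pnorm (m := m) (v - A (d k)) x) atTop (𝓝 0) := by
  obtain ⟨d, hd⟩ := hA.exists_seq v
  obtain ⟨φ, -, hφ⟩ := exists_subseq_ae_of_tendsto_l0Dist hd
  exact ⟨d ∘ φ, hφ⟩

section

variable {N : Type*} [AddCommGroup N] [Module (X →ₘ[m] ℝ) N] [NormedL0Module m N]
  {D : Type*} [AddCommGroup D] [Module (X →ₘ[m] ℝ) D]
  {A : D →ₗ[X →ₘ[m] ℝ] M} {A' : D →ₗ[X →ₘ[m] ℝ] N}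

/-- `v` and `w` have the same pointwise distance to corresponding points of the ranges of `A` and
`A'`. For isometric parametrizations with dense ranges this is the graph of the isomorphism. -/
def SamePosition (A : D →ₗ[X →ₘ[m] ℝ] M) (A' : D →ₗ[X →ₘ[m] ℝ] N) (v : M) (w : N) : Prop :=
  ∀ d, pnorm (m := m) (v - A d) = pnorm (m := m) (w - A' d)

theorem SamePosition.symm {v : M} {w : N} (h : SamePosition A A' v w) : SamePosition A' A w v :=
  fun d => (h d).symm

theorem SamePosition.pnorm_eq {v : M} {w : N} (h : SamePosition A A' v w) :
    pnorm (m := m) v = pnorm (m := m) w := by simpa using h 0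

theorem samePosition_of_tendsto (hiso : ∀ d, pnorm (m := m) (A d) = pnorm (m := m) (A' d))
    {v : M} {w : N} {d : ℕ → D}
    (hv : ∀ᵐ x ∂m, Tendsto (fun k => pnorm (m := m) (v - A (d k)) x) atTop (𝓝 0))
    (hw : ∀ᵐ x ∂m, Tendsto (fun k => pnorm (m := m) (w - A' (d k)) x) atTop (𝓝 0)) :
    SamePosition A A' v w := by
  intro e
  apply AEEqFun.ext
  have h1 : ∀ᵐ x ∂m, ∀ k, |pnorm (m := m) (v - A e) x - pnorm (m := m) (A (d k - e)) x| ≤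
      pnorm (m := m) (v - A (d k)) x := ae_all_iff.2 fun k => by
    simpa using abs_pnorm_sub_pnorm_le_ae (m := m) (v - A e) (A (d k - e))
  have h2 : ∀ᵐ x ∂m, ∀ k, |pnorm (m := m) (w - A' e) x - pnorm (m := m) (A' (d k - e)) x| ≤
      pnorm (m := m) (w - A' (d k)) x := ae_all_iff.2 fun k => by
    simpa using abs_pnorm_sub_pnorm_le_ae (m := m) (w - A' e) (A' (d k - e))
  filter_upwards [hv, hw, h1, h2] with x hv hw h1 h2
  rw [← sub_eq_zero, ← abs_nonpos_iff]
  have h3 := hv.add hw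
  rw [add_zero] at h3
  refine ge_of_tendsto' h3 fun k => ?_
  have h4 := h1 k
  rw [hiso] at h4
  rw [abs_le] at h4 ⊢
  have h5 := abs_le.1 (h2 k)
  constructor <;> linarith [h4.1, h4.2, h5.1, h5.2]

theorem SamePosition.exists_seq (hA : HasDenseRange m A) {v : M} {w : N}
    (h : SamePosition A A' v w) : ∃ d : ℕ → D,
      (∀ᵐ x ∂m, Tendsto (fun k => pnorm (m := m) (v - A (d k)) x) atTop (𝓝 0)) ∧
      ∀ᵐ x ∂m, Tendsto (fun k => pnorm (m := m) (w - A' (d k)) x) atTop (𝓝 0) := by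
  obtain ⟨d, hd⟩ := hA.exists_seq_ae v
  refine ⟨d, hd, ?_⟩
  simpa only [h _] using hd

theorem tendsto_pnorm_add (A : D →ₗ[X →ₘ[m] ℝ] M) {v v' : M} {d d' : ℕ → D}
    (h : ∀ᵐ x ∂m, Tendsto (fun k => pnorm (m := m) (v - A (d k)) x) atTop (𝓝 0))
    (h' : ∀ᵐ x ∂m, Tendsto (fun k => pnorm (m := m) (v' - A (d' k)) x) atTop (𝓝 0)) :
    ∀ᵐ x ∂m, Tendsto (fun k => pnorm (m := m) (v + v' - A (d k + d' k)) x) atTop (𝓝 0) := by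
  have hle : ∀ᵐ x ∂m, ∀ k, pnorm (m := m) (v + v' - A (d k + d' k)) x ≤
      pnorm (m := m) (v - A (d k)) x + pnorm (m := m) (v' - A (d' k)) x :=
    ae_all_iff.2 fun k => by
      have h := pnorm_add_le_ae (m := m) (v - A (d k)) (v' - A (d' k))
      rwa [← add_sub_add_comm, ← map_add] at h
  filter_upwards [h, h', hle, ae_all_iff.2 fun k =>
    pnorm_nonneg_ae (m := m) (v + v' - A (d k + d' k))] with x h1 h2 h3 h4
  exact squeeze_zero h4 h3 (by simpa only [add_zero] using h1.add h2)

theorem tendsto_pnorm_smul (A : D →ₗ[X →ₘ[m] ℝ] M) (f : X →ₘ[m] ℝ) {v : M} {d : ℕ → D}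
    (h : ∀ᵐ x ∂m, Tendsto (fun k => pnorm (m := m) (v - A (d k)) x) atTop (𝓝 0)) :
    ∀ᵐ x ∂m, Tendsto (fun k => pnorm (m := m) (f • v - A (f • d k)) x) atTop (𝓝 0) := by
  have heq : ∀ᵐ x ∂m, ∀ k, pnorm (m := m) (f • v - A (f • d k)) x =
      |f x| * pnorm (m := m) (v - A (d k)) x := ae_all_iff.2 fun k => by
    rw [map_smul, ← smul_sub]
    exact pnorm_smul_ae f _
  filter_upwards [h, heq] with x h1 h2
  simp only [h2]
  simpa only [mul_zero] using h1.const_mul |f x|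

theorem SamePosition.add (hA : HasDenseRange m A)
    (hiso : ∀ d, pnorm (m := m) (A d) = pnorm (m := m) (A' d)) {v v' : M} {w w' : N}
    (h : SamePosition A A' v w) (h' : SamePosition A A' v' w') :
    SamePosition A A' (v + v') (w + w') := by
  obtain ⟨d, h1, h2⟩ := h.exists_seq hA
  obtain ⟨d', h1', h2'⟩ := h'.exists_seq hA
  exact samePosition_of_tendsto hiso (tendsto_pnorm_add A h1 h1') (tendsto_pnorm_add A' h2 h2')

theorem SamePosition.smul (hA : HasDenseRange m A)
    (hiso : ∀ d, pnorm (m := m) (A d) = pnorm (m := m) (A' d)) {v : M} {w : N}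
    (h : SamePosition A A' v w) (f : X →ₘ[m] ℝ) : SamePosition A A' (f • v) (f • w) := by
  obtain ⟨d, h1, h2⟩ := h.exists_seq hA
  exact samePosition_of_tendsto hiso (tendsto_pnorm_smul A f h1) (tendsto_pnorm_smul A' f h2)

theorem SamePosition.unique (hA : HasDenseRange m A) {v : M} {w w' : N}
    (h : SamePosition A A' v w) (h' : SamePosition A A' v w') : w = w' := by
  obtain ⟨d, h1, h2⟩ := h.exists_seq hA
  rw [← sub_eq_zero]
  apply eq_zero_of_pnorm_ae (m := m)
  have hle : ∀ᵐ x ∂m, ∀ k, pnorm (m := m) (w - w') x ≤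
      pnorm (m := m) (w - A' (d k)) x + pnorm (m := m) (v - A (d k)) x := ae_all_iff.2 fun k => by
    rw [h' (d k), pnorm_sub_comm w' (A' (d k))]
    exact pnorm_sub_le_ae _ _ _
  filter_upwards [h1, h2, hle, pnorm_nonneg_ae (m := m) (w - w')] with x h1 h2 h3 h4
  exact le_antisymm (ge_of_tendsto' (by simpa using h2.add h1) h3) h4

theorem exists_samePosition (hA : HasDenseRange m A)
    (hiso : ∀ d, pnorm (m := m) (A d) = pnorm (m := m) (A' d)) (v : M) :
    ∃ w, SamePosition A A' v w := by
  obtain ⟨d, hd⟩ := hA.exists_seq v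
  -- The images under `A'` of an approximating sequence are Cauchy.
  obtain ⟨w, hw⟩ := complete (m := m) (fun k => A' (d k)) fun ε hε => by
    obtain ⟨K, hK⟩ := eventually_atTop.1 (hd.eventually (gt_mem_nhds (half_pos hε)))
    refine ⟨K, fun i hi j hj => ?_⟩
    rw [← map_sub, ← hiso, map_sub]
    refine (l0Dist_zero_le_add (g := pnorm (m := m) (v - A (d i)))
      (h := pnorm (m := m) (v - A (d j))) ?_).trans_lt (by linarith [hK i hi, hK j hj])
    have h := pnorm_sub_le_ae (m := m) (A (d i)) v (A (d j))
    rw [pnorm_sub_comm (A (d i)) v] at h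
    filter_upwards [h, pnorm_nonneg_ae (m := m) (A (d i) - A (d j))] with x hx h0
    rw [abs_of_nonneg h0]
    exact hx.trans (add_le_add (le_abs_self _) (le_abs_self _))
  obtain ⟨φ, hφ, hφ'⟩ := exists_subseq_ae_of_tendsto_l0Dist hd
  obtain ⟨ψ, hψ, hψ'⟩ := exists_subseq_ae_of_tendsto_l0Dist (hw.comp hφ.tendsto_atTop)
  refine ⟨w, samePosition_of_tendsto hiso (d := d ∘ φ ∘ ψ) ?_ ?_⟩
  · filter_upwards [hφ'] with x hx
    exact hx.comp hψ.tendsto_atTop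
  · simpa only [Function.comp, pnorm_sub_comm w] using hψ'

/-- Normed modules with isometric parametrizations of dense subsets by the same module are
isomorphic. -/
theorem isomorphic_of_hasDenseRange (hA : HasDenseRange m A) (hA' : HasDenseRange m A')
    (hiso : ∀ d, pnorm (m := m) (A d) = pnorm (m := m) (A' d)) : Isomorphic m M N := by
  choose F hF using exists_samePosition hA hiso
  choose G hG using exists_samePosition hA' fun d => (hiso d).symm
  refine ⟨{ toFun := F
            invFun := G
            map_add' := fun v v' => (hF _).unique hA ((hF v).add hA hiso (hF v'))
            map_smul' := fun f v => (hF _).unique hA ((hF v).smul hA hiso f)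
            left_inv := fun v => (hG _).unique hA' (hF v).symm
            right_inv := fun w => (hF _).unique hA (hG w).symm },
    fun v => (hF v).pnorm_eq.ge, fun w => (hG w).pnorm_eq.ge⟩

end

/-! ### Gluing and coefficientwise approximation -/

/-- The class of the indicator function of a measurable set. -/
noncomputable def indicatorL0 (m : Measure X) {S : Set X} (hS : MeasurableSet S) : X →ₘ[m] ℝ :=
  AEEqFun.mk (S.indicator 1) (measurable_one.indicator hS).aestronglyMeasurable

/-- If almost every fibre norm of `w - A (e k)` has infimum `0` over `k`, then `w` is a limit of
elements of the range of `A`: glue the `e k` along the measurable sets where they improve the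
approximation. -/
theorem exists_moduleDist_lt_of_ae_forall_exists {D : Type*} [AddCommGroup D]
    [Module (X →ₘ[m] ℝ) D] (A : D →ₗ[X →ₘ[m] ℝ] M) (w : M) (e : ℕ → D)
    (h : ∀ᵐ x ∂m, ∀ ε : ℝ, 0 < ε → ∃ k, pnorm (m := m) (w - A (e k)) x < ε)
    {ε : ℝ} (hε : 0 < ε) : ∃ d, moduleDist m w (A d) < ε := by
  have hS : ∀ (k : ℕ) (d : D), MeasurableSet
      {x | pnorm (m := m) (w - A (e k)) x < pnorm (m := m) (w - A d) x} := fun k d =>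
    measurableSet_lt (AEEqFun.measurable _) (AEEqFun.measurable _)
  let d : ℕ → D := fun k => Nat.rec 0 (fun k d => d + indicatorL0 m (hS k d) • (e k - d)) k
  have hd : ∀ k, d (k + 1) = d k + indicatorL0 m (hS k (d k)) • (e k - d k) := fun k => rfl
  have hstep : ∀ᵐ x ∂m, ∀ k, pnorm (m := m) (w - A (d (k + 1))) x ≤
      min (pnorm (m := m) (w - A (e k)) x) (pnorm (m := m) (w - A (d k)) x) := by
    refine ae_all_iff.2 fun k => ?_
    set χ := indicatorL0 m (hS k (d k)) with hχ
    have hsplit : w - A (d (k + 1)) = (1 - χ) • (w - A (d k)) + χ • (w - A (e k)) := by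
      rw [hd, map_add, map_smul, map_sub]
      module
    rw [hsplit]
    filter_upwards [pnorm_add_le_ae (m := m) ((1 - χ) • (w - A (d k))) (χ • (w - A (e k))),
      pnorm_smul_ae (1 - χ) (w - A (d k)), pnorm_smul_ae χ (w - A (e k)),
      AEEqFun.coeFn_sub 1 χ, AEEqFun.coeFn_one (α := X) (β := ℝ) (μ := m),
      AEEqFun.coeFn_mk (μ := m) (Set.indicator _ (1 : X → ℝ))
        (measurable_one.indicator (hS k (d k))).aestronglyMeasurable] with x h1 h2 h3 h4 h5 h6
    change χ x = _ at h6
    refine h1.trans ?_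
    rw [h2, h3, h4, Pi.sub_apply, h5, h6]
    by_cases hx : pnorm (m := m) (w - A (e k)) x < pnorm (m := m) (w - A (d k)) x
    · rw [Set.indicator_of_mem (by exact hx), min_eq_left hx.le]; simp
    · rw [Set.indicator_of_notMem (by exact hx), min_eq_right (not_lt.1 hx)]; simp
  have hlim : ∀ᵐ x ∂m, Tendsto (fun k => pnorm (m := m) (w - A (d k)) x) atTop (𝓝 0) := by
    filter_upwards [h, hstep, ae_all_iff.2 fun k => pnorm_nonneg_ae (m := m) (w - A (d k))]
      with x h1 h2 h3
    have hanti : Antitone fun k => pnorm (m := m) (w - A (d k)) x :=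
      antitone_nat_of_succ_le fun k => (h2 k).trans (min_le_right _ _)
    refine Metric.tendsto_atTop.2 fun ε hε => ?_
    obtain ⟨k, hk⟩ := h1 ε hε
    refine ⟨k + 1, fun n hn => ?_⟩
    rw [Real.dist_eq, sub_zero, abs_of_nonneg (h3 n)]
    exact (hanti hn).trans_lt (((h2 k).trans (min_le_left _ _)).trans_lt hk)
  obtain ⟨k, hk⟩ := ((tendsto_l0Dist_of_ae hlim).eventually (gt_mem_nhds hε)).exists
  exact ⟨d k, hk⟩

theorem pnorm_sum_smul_le_ae {v : ℕ → M} (hv : ∀ n, ∀ᵐ x ∂m, pnorm (m := m) (v n) x ≤ 1)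
    (f : ℕ → X →ₘ[m] ℝ) (s : Finset ℕ) :
    ∀ᵐ x ∂m, pnorm (m := m) (∑ n ∈ s, f n • v n) x ≤ ∑ n ∈ s, |f n x| := by
  classical
  induction s using Finset.induction_on with
  | empty =>
    rw [Finset.sum_empty, pnorm_zero]
    filter_upwards [AEEqFun.coeFn_zero (α := X) (β := ℝ) (μ := m)] with x hx
    simp [hx]
  | insert n s hn ih =>
    rw [Finset.sum_insert hn]
    filter_upwards [ih, pnorm_add_le_ae (m := m) (f n • v n) (∑ n ∈ s, f n • v n),
      pnorm_smul_ae (f n) (v n), hv n] with x h1 h2 h3 h4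
    rw [Finset.sum_insert hn]
    rw [h3] at h2
    have h5 := mul_le_of_le_one_right (abs_nonneg (f n x)) h4
    linarith

/-- Linear combinations depend on their coefficients in a Lipschitz way. -/
theorem abs_pnorm_linearCombination_sub_le_ae {v : ℕ → M}
    (hv : ∀ n, ∀ᵐ x ∂m, pnorm (m := m) (v n) x ≤ 1) (d : ℕ →₀ (X →ₘ[m] ℝ)) (b : ℕ →₀ ℚ)
    {s : Finset ℕ} (hd : d.support ⊆ s) (hb : b.support ⊆ s) :
    ∀ᵐ x ∂m, |pnorm (m := m) (Finsupp.linearCombination (X →ₘ[m] ℝ) v d) x -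
      pnorm (m := m) (Finsupp.linearCombination (X →ₘ[m] ℝ) v (ratFamily m b)) x| ≤
      ∑ n ∈ s, |d n x - b n| := by
  have hsum : Finsupp.linearCombination (X →ₘ[m] ℝ) v d -
      Finsupp.linearCombination (X →ₘ[m] ℝ) v (ratFamily m b) =
        ∑ n ∈ s, (d n - ratConst m (b n)) • v n := by
    rw [← map_sub, Finsupp.linearCombination_apply, Finsupp.sum_of_support_subset _ (s := s)]
    · rfl
    · intro n hn
      by_contra hns
      have h1 : d n = 0 := Finsupp.notMem_support_iff.1 fun h => hns (hd h)
      have h2 : b n = 0 := Finsupp.notMem_support_iff.1 fun h => hns (hb h)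
      refine Finsupp.mem_support_iff.1 hn ?_
      rw [Finsupp.sub_apply, ratFamily_apply, h1, h2, map_zero, sub_zero]
    · exact fun n _ => zero_smul _ _
  filter_upwards [abs_pnorm_sub_pnorm_le_ae (m := m) (Finsupp.linearCombination (X →ₘ[m] ℝ) v d)
    (Finsupp.linearCombination (X →ₘ[m] ℝ) v (ratFamily m b)),
    pnorm_sum_smul_le_ae hv (fun n => d n - ratConst m (b n)) s,
    ae_all_iff.2 fun n => coeFn_ratConst (m := m) (b n),
    ae_all_iff.2 fun n => AEEqFun.coeFn_sub (d n) (ratConst m (b n))] with x h1 h2 h3 h4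
  rw [hsum] at h1
  refine (h1.trans h2).trans_eq (Finset.sum_congr rfl fun n _ => ?_)
  rw [h4, Pi.sub_apply, h3]

/-- Families with norm at most `1` whose rational combinations have equal pointwise norms have
the same pointwise norms for all combinations. -/
theorem pnorm_linearCombination_eq {N : Type*} [AddCommGroup N] [Module (X →ₘ[m] ℝ) N]
    [NormedL0Module m N] {v : ℕ → M} {w : ℕ → N}
    (hv : ∀ n, ∀ᵐ x ∂m, pnorm (m := m) (v n) x ≤ 1) (hw : ∀ n, ∀ᵐ x ∂m, pnorm (m := m) (w n) x ≤ 1)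
    (hvw : ∀ b, pnorm (m := m) (Finsupp.linearCombination (X →ₘ[m] ℝ) v (ratFamily m b)) =
      pnorm (m := m) (Finsupp.linearCombination (X →ₘ[m] ℝ) w (ratFamily m b)))
    (d : ℕ →₀ (X →ₘ[m] ℝ)) :
    pnorm (m := m) (Finsupp.linearCombination (X →ₘ[m] ℝ) v d) =
      pnorm (m := m) (Finsupp.linearCombination (X →ₘ[m] ℝ) w d) := by
  classical
  apply AEEqFun.ext
  have h : ∀ᵐ x ∂m, ∀ b : ℕ →₀ ℚ, b.support ⊆ d.support →
      |pnorm (m := m) (Finsupp.linearCombination (X →ₘ[m] ℝ) v d) x -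
        pnorm (m := m) (Finsupp.linearCombination (X →ₘ[m] ℝ) w d) x| ≤
      2 * ∑ n ∈ d.support, |d n x - b n| := by
    refine ae_all_iff.2 fun b => ?_
    by_cases hb : b.support ⊆ d.support
    · filter_upwards [abs_pnorm_linearCombination_sub_le_ae hv d b subset_rfl hb,
        abs_pnorm_linearCombination_sub_le_ae hw d b subset_rfl hb] with x h1 h2 _
      rw [hvw] at h1
      rw [abs_le] at h1 h2 ⊢
      constructor <;> linarith [h1.1, h1.2, h2.1, h2.2]
    · exact ae_of_all _ fun x h => absurd h hb
  filter_upwards [h] with x hx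
  rw [← sub_eq_zero, ← abs_nonpos_iff]
  refine le_of_forall_pos_le_add fun ε hε => ?_
  rw [zero_add]
  -- Choose rational coefficients close to the values of `d` at `x`.
  have hη : 0 < ε / (2 * (d.support.card + 1)) := by positivity
  choose q hq using fun n => exists_rat_btwn (sub_lt_self (d n x) hη)
  let b : ℕ →₀ ℚ := Finsupp.onFinset d.support (fun n => if n ∈ d.support then q n else 0)
    fun n hn => by
      by_contra h
      exact hn (if_neg h)
  refine (hx b Finsupp.support_onFinset_subset).trans ?_
  have hle : ∑ n ∈ d.support, |d n x - b n| ≤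
      ∑ n ∈ d.support, ε / (2 * (d.support.card + 1)) := by
    refine Finset.sum_le_sum fun n hn => ?_
    have hbn : b n = q n := if_pos hn
    rw [hbn, abs_le]
    constructor <;> linarith [(hq n).1, (hq n).2]
  rw [Finset.sum_const, nsmul_eq_mul] at hle
  have h2 : (d.support.card : ℝ) * (ε / (2 * (d.support.card + 1))) ≤ ε / 2 := by
    rw [mul_div_assoc', div_le_div_iff₀ (by positivity) two_pos]
    nlinarith
  linarith

end NormedL0Module

/-! ### The bundle generated by a sequence of sections -/

section

variable {V : Type*} [NormedAddCommGroup V] [NormedSpace ℝ V]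

theorem norm_linearCombination_le_l1Norm {φ : ℕ → V} (hφ : ∀ n, ‖φ n‖ ≤ 1) (d : ℕ →₀ ℝ) :
    ‖Finsupp.linearCombination ℝ φ d‖ ≤ l1Norm d := by
  rw [Finsupp.linearCombination_apply]
  refine (norm_sum_le _ _).trans (Finset.sum_le_sum fun n _ => ?_)
  rw [norm_smul, Real.norm_eq_abs]
  exact mul_le_of_le_one_right (abs_nonneg _) (hφ n)

theorem ratComb_mem_span (φ : ℕ → V) (a : ℕ →₀ ℚ) :
    ratComb φ a ∈ Submodule.span ℝ (Set.range φ) :=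
  Submodule.sum_mem _ fun n _ => Submodule.smul_mem _ _ (Submodule.subset_span ⟨n, rfl⟩)

/-- Rational combinations are dense in the closed linear span. -/
theorem exists_norm_sub_ratComb_lt {φ : ℕ → V} (hφ : ∀ n, ‖φ n‖ ≤ 1) {v : V}
    (hv : v ∈ (Submodule.span ℝ (Set.range φ)).topologicalClosure) {ε : ℝ} (hε : 0 < ε) :
    ∃ a, ‖v - ratComb φ a‖ < ε := by
  obtain ⟨y, hy, hvy⟩ := Metric.mem_closure_iff.1 hv (ε / 2) (half_pos hε)
  rw [SetLike.mem_coe, ← Finsupp.range_linearCombination] at hy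
  obtain ⟨d, rfl⟩ := hy
  obtain ⟨b, hb⟩ := exists_rat_l1Norm_sub_lt d (half_pos hε)
  refine ⟨b, ?_⟩
  have h := norm_linearCombination_le_l1Norm hφ (d - ratToReal b)
  rw [map_sub, linearCombination_ratToReal] at h
  rw [dist_eq_norm] at hvy
  have h2 := norm_sub_le_norm_sub_add_norm_sub v (Finsupp.linearCombination ℝ φ d) (ratComb φ b)
  linarith

end

section

variable {X : Type*} [MeasurableSpace X] {B : Type*} [NormedAddCommGroup B] [NormedSpace ℝ B]
  [MeasurableSpace B] [BorelSpace B] [SecondCountableTopology B]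

theorem measurable_ratComb {σ : X → ℕ → B} (hσ : ∀ n, Measurable fun x => σ x n) (a : ℕ →₀ ℚ) :
    Measurable fun x => ratComb (σ x) a :=
  Finset.measurable_fun_sum _ fun n _ => (hσ n).const_smul _

namespace SeparableBanachBundle

/-- The bundle whose fibres are the closed linear spans of a sequence of measurable maps of norm
at most `1`. -/
def ofSeq (σ : X → ℕ → B) (hσ : ∀ n, Measurable fun x => σ x n) (hσ1 : ∀ x n, ‖σ x n‖ ≤ 1) :
    SeparableBanachBundle X B where
  fiber x := (Submodule.span ℝ (Set.range (σ x))).topologicalClosure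
  isClosed_fiber _ := Submodule.isClosed_topologicalClosure _
  weaklyMeasurable U hU := by
    have h : {x : X | (((Submodule.span ℝ (Set.range (σ x))).topologicalClosure : Set B) ∩
        U).Nonempty} = ⋃ a : ℕ →₀ ℚ, (fun x => ratComb (σ x) a) ⁻¹' U := by
      ext x
      rw [Set.mem_iUnion]
      constructor
      · rintro ⟨v, hv, hvU⟩
        obtain ⟨ε, hε, hεU⟩ := Metric.isOpen_iff.1 hU v hvU
        obtain ⟨a, ha⟩ := exists_norm_sub_ratComb_lt (hσ1 x) hv hε
        exact ⟨a, hεU (by rwa [mem_ball_iff_norm, norm_sub_rev])⟩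
      · rintro ⟨a, ha⟩
        exact ⟨_, Submodule.le_topologicalClosure _ (ratComb_mem_span _ a), ha⟩
    rw [h]
    exact MeasurableSet.iUnion fun a => measurable_ratComb hσ a hU.measurableSet

variable {σ : X → ℕ → B} {hσ : ∀ n, Measurable fun x => σ x n} {hσ1 : ∀ x n, ‖σ x n‖ ≤ 1}
  (m : Measure X)

/-- The generating sequence, as elements of `Γ` of the bundle it generates. -/
def generator (hσ : ∀ n, Measurable fun x => σ x n) (hσ1 : ∀ x n, ‖σ x n‖ ≤ 1) (n : ℕ) :
    (ofSeq σ hσ hσ1).Gamma m :=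
  ⟨AEEqFun.mk (fun x => σ x n) (hσ n).aestronglyMeasurable, fun x => σ x n,
    ⟨hσ n, fun _ => Submodule.le_topologicalClosure _ (Submodule.subset_span ⟨n, rfl⟩)⟩,
    AEEqFun.coeFn_mk _ _⟩

theorem coeFn_generator (n : ℕ) :
    ⇑(generator m hσ hσ1 n).1 =ᵐ[m] fun x => σ x n := AEEqFun.coeFn_mk _ _

open NormedL0Module

theorem coeFn_linearCombination_generator (a : ℕ →₀ ℚ) :
    ⇑(Finsupp.linearCombination (X →ₘ[m] ℝ) (generator m hσ hσ1) (ratFamily m a)).1 =ᵐ[m]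
      fun x => ratComb (σ x) a := by
  induction a using Finsupp.induction_linear with
  | zero =>
    rw [map_zero, map_zero, AddSubgroup.coe_zero]
    exact AEEqFun.coeFn_zero
  | add a b ha hb =>
    rw [map_add, map_add, AddSubgroup.coe_add]
    filter_upwards [ha, hb, AEEqFun.coeFn_add
      (Finsupp.linearCombination (X →ₘ[m] ℝ) (generator m hσ hσ1) (ratFamily m a)).1
      (Finsupp.linearCombination (X →ₘ[m] ℝ) (generator m hσ hσ1) (ratFamily m b)).1]
      with x h1 h2 h3
    rw [h3, Pi.add_apply, h1, h2, ratComb_add]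
  | single n r =>
    rw [ratFamily_single, Finsupp.linearCombination_single]
    filter_upwards [coeFn_smul m _ (ratConst m r) (generator m hσ hσ1 n),
      coeFn_generator m (hσ := hσ) (hσ1 := hσ1) n, coeFn_ratConst (m := m) r] with x h1 h2 h3
    rw [h1, h2, h3]
    simp [ratComb]

theorem gammaNorm_generator_le (n : ℕ) :
    ∀ᵐ x ∂m, gammaNorm m _ (generator m hσ hσ1 n) x ≤ 1 := by
  filter_upwards [coeFn_gammaNorm m _ (generator m hσ hσ1 n),
    coeFn_generator m (hσ := hσ) (hσ1 := hσ1) n] with x h1 h2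
  rw [h1, h2]
  exact hσ1 x n

theorem gammaNorm_linearCombination_generator (a : ℕ →₀ ℚ) :
    ∀ᵐ x ∂m, gammaNorm m _ (Finsupp.linearCombination (X →ₘ[m] ℝ) (generator m hσ hσ1)
      (ratFamily m a)) x = ‖ratComb (σ x) a‖ := by
  filter_upwards [coeFn_gammaNorm m _ (Finsupp.linearCombination (X →ₘ[m] ℝ)
    (generator m hσ hσ1) (ratFamily m a)),
    coeFn_linearCombination_generator m (hσ := hσ) (hσ1 := hσ1) a] with x h1 h2
  exact h1.trans (by rw [h2])

/-- Sections of the bundle are limits of `L⁰(m)`-linear combinations of the generators. -/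
theorem hasDenseRange_generator [SigmaFinite m] [CompleteSpace B] : HasDenseRange m
    (Finsupp.linearCombination (X →ₘ[m] ℝ) (generator m hσ hσ1)) := by
  intro s ε hε
  obtain ⟨e, he⟩ := exists_surjective_nat (ℕ →₀ ℚ)
  refine exists_moduleDist_lt_of_ae_forall_exists _ s (fun k => ratFamily m (e k)) ?_ hε
  obtain ⟨τ, hτ, hsτ⟩ := s.2
  filter_upwards [hsτ, ae_all_iff.2 fun k => coeFn_gammaNorm m _
    (s - Finsupp.linearCombination (X →ₘ[m] ℝ) (generator m hσ hσ1) (ratFamily m (e k))),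
    ae_all_iff.2 fun k => coeFn_linearCombination_generator m (hσ := hσ) (hσ1 := hσ1) (e k),
    ae_all_iff.2 fun k => AEEqFun.coeFn_sub s.1
      (Finsupp.linearCombination (X →ₘ[m] ℝ) (generator m hσ hσ1) (ratFamily m (e k))).1]
    with x h1 h2 h3 h4 δ hδ
  obtain ⟨a, ha⟩ := exists_norm_sub_ratComb_lt (hσ1 x) (hτ.2 x) hδ
  obtain ⟨k, rfl⟩ := he a
  refine ⟨k, lt_of_eq_of_lt (h2 k) ?_⟩
  rwa [AddSubgroup.coe_sub, h4, Pi.sub_apply, h1, h3]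

end SeparableBanachBundle

end

/-! ### The seminorms of a countably generated module -/

namespace NormedL0Module

variable {X : Type*} [MeasurableSpace X] {m : Measure X} [SigmaFinite m]
  {M : Type*} [AddCommGroup M] [Module (X →ₘ[m] ℝ) M] [NormedL0Module m M]

/-- Every element is a multiple of one with pointwise norm at most `1`. -/
theorem exists_pnorm_le_one_smul_eq (v : M) :
    ∃ (f : X →ₘ[m] ℝ) (w : M), (∀ᵐ x ∂m, pnorm (m := m) w x ≤ 1) ∧ v = f • w := by
  have hg : Measurable fun x => (1 + |pnorm (m := m) v x|)⁻¹ :=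
    (measurable_const.add (AEEqFun.measurable _).abs).inv
  set g : X →ₘ[m] ℝ := AEEqFun.mk _ hg.aestronglyMeasurable with hg'
  have hgx : ⇑g =ᵐ[m] fun x => (1 + |pnorm (m := m) v x|)⁻¹ := AEEqFun.coeFn_mk _ _
  refine ⟨1 + |pnorm (m := m) v|, g • v, ?_, ?_⟩
  · filter_upwards [hgx, pnorm_smul_ae g v] with x h1 h2
    rw [h2, h1, abs_of_pos (by positivity), inv_mul_le_one₀ (by positivity)]
    linarith [le_abs_self (pnorm (m := m) v x)]
  · have h : (1 + |pnorm (m := m) v|) * g = 1 := by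
      apply AEEqFun.ext
      filter_upwards [hgx, AEEqFun.coeFn_mul (1 + |pnorm (m := m) v|) g,
        AEEqFun.coeFn_add 1 |pnorm (m := m) v|, AEEqFun.coeFn_abs (pnorm (m := m) v),
        AEEqFun.coeFn_one (α := X) (β := ℝ) (μ := m)] with x h1 h2 h3 h4 h5
      rw [h2, Pi.mul_apply, h3, Pi.add_apply, h5, h4, h1, Pi.one_apply]
      exact mul_inv_cancel₀ (by positivity)
    rw [smul_smul, h, one_smul]

theorem CountablyGenerated.exists_seq (hM : CountablyGenerated m M) :
    ∃ v : ℕ → M, (∀ n, ∀ᵐ x ∂m, pnorm (m := m) (v n) x ≤ 1) ∧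
      HasDenseRange m (Finsupp.linearCombination (X →ₘ[m] ℝ) v) := by
  obtain ⟨C, hC, hdense⟩ := hM
  obtain ⟨e, he⟩ := (hC.insert 0).exists_eq_range (Set.insert_nonempty _ _)
  choose f v hv hfv using fun n => exists_pnorm_le_one_smul_eq (m := m) (e n)
  refine ⟨v, hv, fun u ε hε => ?_⟩
  obtain ⟨w, hw, hlt⟩ := hdense u ε hε
  have hle : Submodule.span (X →ₘ[m] ℝ) C ≤
      LinearMap.range (Finsupp.linearCombination (X →ₘ[m] ℝ) v) := by
    rw [Finsupp.range_linearCombination, Submodule.span_le]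
    intro c hc
    obtain ⟨n, rfl⟩ : c ∈ Set.range e := he ▸ Set.mem_insert_of_mem 0 hc
    rw [hfv n]
    exact Submodule.smul_mem _ _ (Submodule.subset_span ⟨n, rfl⟩)
  obtain ⟨d, rfl⟩ := hle hw
  exact ⟨d, hlt⟩

theorem isRatSeminorm_pnorm_ae {v : ℕ → M} (hv : ∀ n, ∀ᵐ x ∂m, pnorm (m := m) (v n) x ≤ 1) :
    ∀ᵐ x ∂m, IsRatSeminorm fun a =>
      pnorm (m := m) (Finsupp.linearCombination (X →ₘ[m] ℝ) v (ratFamily m a)) x := by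
  have h1 : ∀ᵐ x ∂m, ∀ a b,
      pnorm (m := m) (Finsupp.linearCombination (X →ₘ[m] ℝ) v (ratFamily m (a + b))) x ≤
      pnorm (m := m) (Finsupp.linearCombination (X →ₘ[m] ℝ) v (ratFamily m a)) x +
      pnorm (m := m) (Finsupp.linearCombination (X →ₘ[m] ℝ) v (ratFamily m b)) x := by
    refine ae_all_iff.2 fun a => ae_all_iff.2 fun b => ?_
    rw [map_add, map_add]
    exact pnorm_add_le_ae _ _
  have h2 : ∀ᵐ x ∂m, ∀ (r : ℚ) a,
      pnorm (m := m) (Finsupp.linearCombination (X →ₘ[m] ℝ) v (ratFamily m (r • a))) x =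
      |(r : ℝ)| * pnorm (m := m) (Finsupp.linearCombination (X →ₘ[m] ℝ) v (ratFamily m a)) x := by
    refine ae_all_iff.2 fun r => ae_all_iff.2 fun a => ?_
    rw [ratFamily_smul, map_smul]
    filter_upwards [pnorm_smul_ae (ratConst m r)
      (Finsupp.linearCombination (X →ₘ[m] ℝ) v (ratFamily m a)),
      coeFn_ratConst (m := m) r] with x h h'
    rw [h, h']
  filter_upwards [h1, h2, ae_all_iff.2 hv] with x h1 h2 h3
  refine ⟨h1, h2, fun n => ?_⟩
  rw [ratFamily_single, ratConst_one, Finsupp.linearCombination_single, one_smul]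
  exact h3 n

/-- The seminorms given by rational combinations of a sequence in a normed module can be
represented by seminorms at every point, measurable in the point. -/
theorem exists_measurable_isRatSeminorm {v : ℕ → M}
    (hv : ∀ n, ∀ᵐ x ∂m, pnorm (m := m) (v n) x ≤ 1) :
    ∃ p : X → (ℕ →₀ ℚ) → ℝ, (∀ x, IsRatSeminorm (p x)) ∧ (∀ a, Measurable fun x => p x a) ∧
      ∀ a, ∀ᵐ x ∂m, p x a =
        pnorm (m := m) (Finsupp.linearCombination (X →ₘ[m] ℝ) v (ratFamily m a)) x := by
  classical
  obtain ⟨S, hS, hSm, hS0⟩ := exists_measurable_superset_of_null (isRatSeminorm_pnorm_ae hv)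
  refine ⟨fun x a => if x ∈ S then 0 else
    pnorm (m := m) (Finsupp.linearCombination (X →ₘ[m] ℝ) v (ratFamily m a)) x,
    fun x => ?_, fun a => measurable_const.ite hSm (AEEqFun.measurable _), fun a => ?_⟩
  · by_cases hx : x ∈ S
    · simp only [if_pos hx]
      exact ⟨by simp, by simp, by simp⟩
    · simp only [if_neg hx]
      exact not_not.1 fun h => hx (hS h)
  · filter_upwards [measure_eq_zero_iff_ae_notMem.1 hS0] with x hx
    rw [if_neg hx]

end NormedL0Module

theorem mainTheorem1 {X : Type*} [MeasurableSpace X] (m : Measure X) [SigmaFinite m]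
    [m.IsComplete]
    {M : Type*} [AddCommGroup M] [Module (X →ₘ[m] ℝ) M] [NormedL0Module m M]
    (hM : NormedL0Module.CountablyGenerated m M)
    {B : Type*} [NormedAddCommGroup B] [NormedSpace ℝ B] [CompleteSpace B]
    [SecondCountableTopology B] [MeasurableSpace B] [BorelSpace B]
    (hB : IsUniversalSeparableBanach B) :
    ∃ E : SeparableBanachBundle X B, NormedL0Module.Isomorphic m (E.Gamma m) M := by
  obtain ⟨v, hv, hdense⟩ := hM.exists_seq
  obtain ⟨p, hp, hpm, hpv⟩ := NormedL0Module.exists_measurable_isRatSeminorm hv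
  obtain ⟨s, hs, hsp⟩ := exists_stronglyMeasurable_norm_ratComb_eq hp hpm
  obtain ⟨j⟩ := hB C(ℕ → Bool, ℝ)
  let σ : X → ℕ → B := fun x n => j (s x n)
  have hσ : ∀ n, Measurable fun x => σ x n := fun n =>
    (j.continuous.comp_stronglyMeasurable (hs n)).measurable
  have hσp : ∀ x a, ‖ratComb (σ x) a‖ = p x a := fun x a => by
    rw [← hsp x a, ← j.norm_map, map_ratComb]
  have hσ1 : ∀ x n, ‖σ x n‖ ≤ 1 := fun x n => by
    have h := (hσp x (Finsupp.single n 1)).trans_le ((hp x).single_le n)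
    simpa [ratComb] using h
  refine ⟨.ofSeq σ hσ hσ1, NormedL0Module.isomorphic_of_hasDenseRange
    (SeparableBanachBundle.hasDenseRange_generator m) hdense fun d => ?_⟩
  refine NormedL0Module.pnorm_linearCombination_eq
    (SeparableBanachBundle.gammaNorm_generator_le m) hv (fun b => ?_) d
  apply AEEqFun.ext
  filter_upwards [SeparableBanachBundle.gammaNorm_linearCombination_generator m
    (hσ := hσ) (hσ1 := hσ1) b, hpv b] with x h1 h2
  exact h1.trans ((hσp x b).trans h2)
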